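/- Let $1\le p_0<p<\infty$ with $p>1$, and let $X=(X,d,\mu)$ be a metric space with at least two points, equipped with a complete Borel measure $\mu$ (the completion of a measure on the Borel $\sigma$-algebra) such that $0<\mu(B)<\infty$ for all balls $B$. Fix $x_0\in X$ and write $B_r=B(x_0,r)=\{y\in X: d(x_0,y)<r\}$. Let $0<R_0\le\infty$ and assume that there are constants $\xi>1$, $C_{\rm rd}>1$, $C_{\rm d}>0$, $C_{\rm P}>0$ and $\lambda\ge1$ such that: (i) ($\mu$ is reverse-doubling at $x_0$ for radii up to $R_0$, with constant $\xi$) $\mu(B_{\xi r})\ge C_{\rm rd}\,\mu(B_r)$ for all finite $0<r\le R_0$; (ii) ($\mu$ is doubling at $x_0$ for radii up to $\max\{1,\tfrac12\xi\}R_0$) $\mu(B_{2r})\le C_{\rm d}\,\mu(B_r)$ for all finite $0<r\le\max\{1,\tfrac12\xi\}R_0$; (iii) ($\mu$ supports a $p_0$-Poincaré inequality at $x_0$ for radii up to $\max\{2,\xi\}R_0$) for all finite $0<r\le\max\{2,\xi\}R_0$, all integrable $u:X\to[-\infty,\infty]$ and all $p_0$-weak upper gradients $g$ of $u$, $$\frac1{\mu(B_r)}\int_{B_r}|u-u_{B_r}|\,d\mu\le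 C_{\rm P}\,r\Bigl(\frac1{\mu(B_{\lambda r})}\int_{B_{\lambda r}}g^{p_0}\,d\mu\Bigr)^{1/p_0},\qquad u_{B_r}=\frac1{\mu(B_r)}\int_{B_r}u\,d\mu .$$ Then there is a constant $A>0$, depending only on $p$, $p_0$, $\xi$, $C_{\rm rd}$, $C_{\rm d}$, $C_{\rm P}$ and $\lambda$ (in particular not on $R_0$, and not on $X$, $\mu$, $x_0$, $r$ or $R$), such that for all finite $r,R$ with $0<2r\le R\le R_0$, $$\frac1A\biggl(\int_r^R\Bigl(\frac{\rho}{\mu(B_\rho)}\Bigr)^{1/(p-1)}d\rho\biggr)^{1-p}\le \operatorname{cap}_p(B_r,B_R)\le A\biggl(\int_r^R\Bigl(\frac{\rho}{\mu(B_\rho)}\Bigr)^{1/(p-1)}d\rho\biggr)^{1-p}.$$ Here, for $q\ge1$, a measurable $g:X\to[0,\infty]$ is a $q$-weak upper gradient of $u:X\to[-\infty,\infty]$ if $|u(\gamma(0))-u(\gamma(l_\gamma))|\le\int_\gamma g\,ds$ (the left-hand side being $\infty$ if one of its terms is $\pm\infty$) for all nonconstant compact rectifiable curves $\gamma:[0,l_\gamma]\to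 X$, parametrized by arc length, outside a family of zero $q$-modulus, that is, a family $\Gamma$ for which there is a Borel function $\rho:X\to[0,\infty]$ in $L^q_{\rm loc}(X)$ with $\int_\gamma\rho\,ds=\infty$ for every $\gamma\in\Gamma$. The space $N^{1,p}(X)$ consists of the measurable $u:X\to[-\infty,\infty]$, defined everywhere, with $\int_X|u|^p\,d\mu+\inf_g\int_X g^p\,d\mu<\infty$, the infimum being over all $p$-weak upper gradients $g$ of $u$. For $\Omega\subset X$ open and $E\subset\Omega$, $$\operatorname{cap}_p(E,\Omega)=\inf_u\int_\Omega g_u^p\,d\mu,$$ where the infimum is over all $u\in N^{1,p}(X)$ with $u\ge1$ on $E$ and $u=0$ on $X\setminus\Omega$, and where $g_u$ is the minimal $p$-weak upper gradient of $u$, so that $\int_\Omega g_u^p\,d\mu=\inf_g\int_\Omega g^p\,d\mu$ over all $p$-weak upper gradients $g\in L^p_{\rm loc}(X)$ of $u$. -/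

import Mathlib

open MeasureTheory Set
open scoped ENNReal NNReal

/-- A nonconstant compact rectifiable curve in `X`, parametrized by arc length on `[0, len]`
(the values of `toFun` outside `[0, len]` play no role). -/
structure RectCurve (X : Type*) [PseudoEMetricSpace X] where
  len : ℝ
  len_pos : 0 < len
  toFun : ℝ → X
  unitSpeed : HasUnitSpeedOn toFun (Icc 0 len)

/-- The line integral `∫_γ g ds`. -/
noncomputable def RectCurve.lineIntegral {X : Type*} [PseudoEMetricSpace X]
    (γ : RectCurve X) (g : X → ℝ≥0∞) : ℝ≥0∞ :=
  ∫⁻ t in Icc 0 γ.len, g (γ.toFun t)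

/-- `g ∈ L^p_loc(X)`, as far as finiteness of integrals is concerned: every point has a ball
on which `g^p` has finite integral. -/
def LocLp {X : Type*} [MetricSpace X] [MeasurableSpace X] (p : ℝ) (μ : Measure X)
    (g : X → ℝ≥0∞) : Prop :=
  ∀ x : X, ∃ r : ℝ, 0 < r ∧ ∫⁻ y in Metric.ball x r, g y ^ p ∂μ < ⊤

/-- The curve family `Γ` has zero `p`-modulus. -/
def ZeroModulus {X : Type*} [MetricSpace X] [MeasurableSpace X] (p : ℝ) (μ : Measure X)
    (Γ : Set (RectCurve X)) : Prop :=
  ∃ ρ : X → ℝ≥0∞, Measurable ρ ∧ LocLp p μ ρ ∧ ∀ γ ∈ Γ, γ.lineIntegral ρ = ⊤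

/-- `g` is a `p`-weak upper gradient of `u : X → [-∞, ∞]`. Measurability is with respect to the
completion of `μ`. In `EReal` the number `(a - b).abs` is `|a - b|` for finite `a`, `b`, and it
is `⊤` as soon as one of `a`, `b` is infinite, which is the usual convention here. -/
def IsWeakUpperGradient {X : Type*} [MetricSpace X] [MeasurableSpace X] (p : ℝ) (μ : Measure X)
    (u : X → EReal) (g : X → ℝ≥0∞) : Prop :=
  AEMeasurable g μ ∧
    ZeroModulus p μ
      {γ : RectCurve X |
        ¬ (u (γ.toFun 0) - u (γ.toFun γ.len)).abs ≤ γ.lineIntegral g}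

/-- `u` belongs to the Newtonian space `N^{1,p}(X)`, that is, `u` is a measurable function defined
everywhere with `∫ |u|^p dμ + inf_g ∫ g^p dμ < ∞`. -/
def MemNewtonian {X : Type*} [MetricSpace X] [MeasurableSpace X] (p : ℝ) (μ : Measure X)
    (u : X → EReal) : Prop :=
  AEMeasurable u μ ∧
    (∫⁻ x, (u x).abs ^ p ∂μ) +
      (⨅ (g : X → ℝ≥0∞) (_ : IsWeakUpperGradient p μ u g), ∫⁻ x, g x ^ p ∂μ) < ⊤

/-- The `p`-energy `∫_Ω g_u^p dμ`, where the minimal `p`-weak upper gradient `g_u` is the a.e.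
smallest `p`-weak upper gradient of `u` in `L^p_loc(X)`, so that the energy is the smallest value
of `∫_Ω g^p dμ` among all such `g`. -/
noncomputable def pEnergy {X : Type*} [MetricSpace X] [MeasurableSpace X] (p : ℝ)
    (μ : Measure X) (Ω : Set X) (u : X → EReal) : ℝ≥0∞ :=
  ⨅ (g : X → ℝ≥0∞) (_ : IsWeakUpperGradient p μ u g ∧ LocLp p μ g), ∫⁻ x in Ω, g x ^ p ∂μ

/-- The variational capacity `cap_p(E, Ω)` of `E ⊆ Ω`, `Ω` open: the infimum of the `p`-energy in
`Ω` over all `u ∈ N^{1,p}_0(Ω)` (extended by zero outside `Ω`) with `u ≥ 1` on `E`. -/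
noncomputable def varCap {X : Type*} [MetricSpace X] [MeasurableSpace X] (p : ℝ)
    (μ : Measure X) (E Ω : Set X) : ℝ≥0∞ :=
  ⨅ (u : X → EReal)
    (_ : MemNewtonian p μ u ∧ (∀ x ∉ Ω, u x = 0) ∧ (∀ x ∈ E, 1 ≤ u x)), pEnergy p μ Ω u

/-- `μ` is doubling at `x₀` for radii up to `R₀ ∈ (0, ∞]`, with constant `C`. -/
def DoublingAt {X : Type*} [MetricSpace X] [MeasurableSpace X] (μ : Measure X) (x₀ : X)
    (C : ℝ) (R₀ : ℝ≥0∞) : Prop :=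
  ∀ r : ℝ, 0 < r → ENNReal.ofReal r ≤ R₀ →
    μ (Metric.ball x₀ (2 * r)) ≤ ENNReal.ofReal C * μ (Metric.ball x₀ r)

/-- `μ` is reverse-doubling at `x₀` for radii up to `R₀ ∈ (0, ∞]`, with constants `ξ` and `C`. -/
def ReverseDoublingAt {X : Type*} [MetricSpace X] [MeasurableSpace X] (μ : Measure X) (x₀ : X)
    (ξ C : ℝ) (R₀ : ℝ≥0∞) : Prop :=
  ∀ r : ℝ, 0 < r → ENNReal.ofReal r ≤ R₀ →
    ENNReal.ofReal C * μ (Metric.ball x₀ r) ≤ μ (Metric.ball x₀ (ξ * r))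

/-- `μ` supports a `q`-Poincaré inequality at `x₀` for radii up to `R₀ ∈ (0, ∞]`, with constant
`C` and dilation `lam`: it is required for all integrable `u : X → [-∞, ∞]` and all `q`-weak upper
gradients `g` of `u`. -/
def PoincareAt {X : Type*} [MetricSpace X] [MeasurableSpace X] (q : ℝ) (μ : Measure X) (x₀ : X)
    (C lam : ℝ) (R₀ : ℝ≥0∞) : Prop :=
  ∀ r : ℝ, 0 < r → ENNReal.ofReal r ≤ R₀ →
    ∀ (u : X → EReal) (g : X → ℝ≥0∞),
      AEMeasurable u μ → ∫⁻ x, (u x).abs ∂μ < ⊤ → IsWeakUpperGradient q μ u g →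
        ⨍⁻ x in Metric.ball x₀ r,
            (u x - ((⨍ y in Metric.ball x₀ r, (u y).toReal ∂μ : ℝ) : EReal)).abs ∂μ ≤
          ENNReal.ofReal (C * r) *
            (⨍⁻ x in Metric.ball x₀ (lam * r), g x ^ q ∂μ) ^ (1 / q)

/-! Write f(ρ) = (ρ/μ(B_ρ))^α with α = 1/(p-1), and let H be the integral of f over (r, R). The
exponent satisfies αp = 1 + α, so f(ρ)^p μ(B_ρ) = ρ f(ρ): the p-energy of f at scale ρ is the
contribution of that scale to H. Both bounds are discretizations of this identity, and 0 < H < ∞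
allows division by H.

Upper bound. The function u(x) = H⁻¹ ∫ f over (r, R) ∩ (d(x, x₀), ∞) is 1 on B_r and 0 outside B_R,
and H⁻¹ f(d(x, x₀)), cut off to r < d(x, x₀) < R, is an upper gradient
(`isWeakUpperGradient_radial`). Splitting the annulus dyadically and using doubling bounds ∫ f(d(x,
x₀))^p dμ by a multiple of H (`lintegral_radialDensity_rpow_le`), so the energy is at most a
multiple of H^(-p) H = H^(1-p).

Lower bound. Truncate an admissible u to [0, 1] and telescope its means along concentric balls B_k
of radii ρ_k growing by the factor ξ, up to ξR. The first mean is 1; the last is controlled by the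
oscillation, because u = 0 on B_{ξR} \ B_R, a fixed fraction of B_{ξR} by reverse doubling
(`one_le_mul_sum_laverage`). With q = p₀, the Poincaré inequality gives 1 ≲ ∑ ρ_k (μ(B_k)⁻¹ ∫_{λB_k}
g^q)^(1/q).

The balls λB_k are nested, so they have no bounded overlap; the gap q < p makes up for this. Let
M(x) be the smallest μ(B_k) with x ∈ B_k. Hölder's inequality with a power of M, together with
∫_{B_k} M^(-1/2) ≤ 2 μ(B_k)^(1/2), bounds the q-mean by a multiple of μ(B_k)^(-1/p) (∫_{λB_k} g^p
(M/μ(B_k))^δ)^(1/p), with δ = (p-q)/(2q). By reverse doubling the weights (M(x)/μ(B_k))^δ decay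
geometrically in k, so their sum is bounded (`sum_nestedMass_le`). Hölder's inequality for the sum
over k then gives 1 ≲ H^((p-1)/p) (∫ g^p)^(1/p) (`sum_mul_rpow_mean_le`, `sum_radialTerm_le`). -/

/-! ### Arc-length curves, subcurves and line integrals -/

section Curves

theorem HasUnitSpeedOn.lipschitzOnWith {E : Type*} [PseudoEMetricSpace E] {f : ℝ → E} {s : Set ℝ}
    (h : HasUnitSpeedOn f s) : LipschitzOnWith 1 f s := by
  have key : ∀ x ∈ s, ∀ y ∈ s, x ≤ y → edist (f x) (f y) ≤ edist x y := by
    intro x hx y hy hxy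
    have h1 := h hx hy
    rw [NNReal.coe_one, one_mul] at h1
    calc edist (f x) (f y) ≤ eVariationOn f (s ∩ Icc x y) :=
          eVariationOn.edist_le f ⟨hx, left_mem_Icc.2 hxy⟩ ⟨hy, right_mem_Icc.2 hxy⟩
      _ = edist x y := by
          rw [h1, edist_comm, edist_dist, Real.dist_eq, abs_of_nonneg (sub_nonneg.2 hxy)]
  intro x hx y hy
  rw [ENNReal.coe_one, one_mul]
  rcases le_total x y with hxy | hxy
  · exact key x hx y hy hxy
  · rw [edist_comm, edist_comm x]
    exact key y hy x hx hxy

/-- The image of Lebesgue measure on [0, l] under φ dominates Lebesgue measure between φ(0) and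
φ(l): φ attains every intermediate value, and a 1-Lipschitz map does not increase one-dimensional
Hausdorff measure. -/
theorem LipschitzOnWith.lintegral_uIoc_le {φ : ℝ → ℝ} {l : ℝ} (hl : 0 ≤ l)
    (hφ : LipschitzOnWith 1 φ (Icc 0 l)) {k : ℝ → ℝ≥0∞} (hk : Measurable k) :
    ∫⁻ s in uIoc (φ 0) (φ l), k s ≤ ∫⁻ t in Icc 0 l, k (φ t) := by
  have hm : AEMeasurable φ (volume.restrict (Icc 0 l)) :=
    hφ.continuousOn.aemeasurable measurableSet_Icc
  rw [← lintegral_map' hk.aemeasurable hm]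
  refine lintegral_mono' ?_ le_rfl
  refine Measure.le_iff.2 fun E hE => ?_
  rw [Measure.restrict_apply hE, Measure.map_apply_of_aemeasurable hm hE]
  have hsub : E ∩ uIoc (φ 0) (φ l) ⊆ φ '' (φ ⁻¹' E ∩ Icc 0 l) := by
    rintro y ⟨hyE, hy⟩
    have hc : ContinuousOn φ (uIcc 0 l) := by rw [uIcc_of_le hl]; exact hφ.continuousOn
    obtain ⟨t, ht, rfl⟩ := intermediate_value_uIcc hc (uIoc_subset_uIcc hy)
    rw [uIcc_of_le hl] at ht
    exact ⟨t, ⟨hyE, ht⟩, rfl⟩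
  calc volume (E ∩ uIoc (φ 0) (φ l)) ≤ volume (φ '' (φ ⁻¹' E ∩ Icc 0 l)) := measure_mono hsub
    _ ≤ volume (φ ⁻¹' E ∩ Icc 0 l) := by
        have := (hφ.mono (inter_subset_right (s := φ ⁻¹' E))).hausdorffMeasure_image_le
          (d := 1) zero_le_one
        simpa [hausdorffMeasure_real] using this
    _ ≤ _ := Measure.le_restrict_apply _ _

namespace RectCurve

variable {X : Type*} [PseudoEMetricSpace X]

theorem lipschitzOnWith (γ : RectCurve X) : LipschitzOnWith 1 γ.toFun (Icc 0 γ.len) :=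
  γ.unitSpeed.lipschitzOnWith

/-- The restriction of a curve to a nondegenerate subinterval `[a, b]`. -/
noncomputable def subcurve (γ : RectCurve X) {a b : ℝ} (ha : 0 ≤ a) (hab : a < b)
    (hb : b ≤ γ.len) : RectCurve X where
  len := b - a
  len_pos := sub_pos.2 hab
  toFun t := γ.toFun (a + t)
  unitSpeed := by
    refine hasConstantSpeedOnWith_iff_ordered.2 fun x hx y hy hxy => ?_
    have h1 := γ.unitSpeed (x := a + x) ⟨by linarith [hx.1], by linarith [hx.2]⟩
      (y := a + y) ⟨by linarith [hy.1], by linarith [hy.2]⟩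
    have h2 := eVariationOn.comp_eq_of_monotoneOn γ.toFun (t := Icc 0 (b - a) ∩ Icc x y)
      (fun t => a + t) (fun s _ t _ hst => by simpa using hst)
    rw [show (γ.toFun ∘ fun t => a + t) = fun t => γ.toFun (a + t) from rfl] at h2
    rw [h2]
    have e1 : Icc 0 (b - a) ∩ Icc x y = Icc x y :=
      inter_eq_right.2 (Icc_subset_Icc hx.1 hy.2)
    have e2 : Icc 0 γ.len ∩ Icc (a + x) (a + y) = Icc (a + x) (a + y) :=
      inter_eq_right.2 (Icc_subset_Icc (by linarith [hx.1]) (by linarith [hy.2]))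
    rw [e1, image_const_add_Icc, ← e2, h1]
    congr 2
    ring

theorem lineIntegral_subcurve (γ : RectCurve X) {a b : ℝ} (ha : 0 ≤ a) (hab : a < b)
    (hb : b ≤ γ.len) (g : X → ℝ≥0∞) :
    (γ.subcurve ha hab hb).lineIntegral g = ∫⁻ t in Icc a b, g (γ.toFun t) := by
  have h := (measurePreserving_add_left (volume : Measure ℝ) a).setLIntegral_comp_preimage_emb
    (measurableEmbedding_addLeft a) (fun t => g (γ.toFun t)) (Icc a b)
  rw [← h, preimage_const_add_Icc, sub_self]
  rfl

theorem lineIntegral_subcurve_le (γ : RectCurve X) {a b : ℝ} (ha : 0 ≤ a) (hab : a < b)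
    (hb : b ≤ γ.len) (g : X → ℝ≥0∞) :
    (γ.subcurve ha hab hb).lineIntegral g ≤ γ.lineIntegral g := by
  rw [lineIntegral_subcurve]
  exact lintegral_mono_set (Icc_subset_Icc ha hb)

@[simp]
theorem subcurve_start (γ : RectCurve X) {a b : ℝ} (ha : 0 ≤ a) (hab : a < b)
    (hb : b ≤ γ.len) : (γ.subcurve ha hab hb).toFun 0 = γ.toFun a := by
  simp [subcurve]

@[simp]
theorem subcurve_end (γ : RectCurve X) {a b : ℝ} (ha : 0 ≤ a) (hab : a < b)
    (hb : b ≤ γ.len) :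
    (γ.subcurve ha hab hb).toFun (γ.subcurve ha hab hb).len = γ.toFun b := by
  simp [subcurve]

end RectCurve

end Curves

/-! ### Weak upper gradients: change of exponent, truncation, restriction to an open set -/

section WeakUpperGradient

variable {X : Type*} [MetricSpace X] [MeasurableSpace X] {p q : ℝ} {μ : Measure X}

theorem abs_coe_sub_coe (a b : ℝ) : ((a : EReal) - (b : EReal)).abs = ENNReal.ofReal |a - b| := by
  rw [← EReal.coe_sub, EReal.abs_def]

theorem ZeroModulus.mono {Γ Γ' : Set (RectCurve X)} (h : ZeroModulus p μ Γ) (hs : Γ' ⊆ Γ) :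
    ZeroModulus p μ Γ' := by
  obtain ⟨ρ, h1, h2, h3⟩ := h
  exact ⟨ρ, h1, h2, fun γ hγ => h3 γ (hs hγ)⟩

theorem rpow_le_one_add_rpow (x : ℝ≥0∞) (hq : 0 ≤ q) (hqp : q ≤ p) : x ^ q ≤ 1 + x ^ p := by
  rcases le_total x 1 with h | h
  · exact (ENNReal.rpow_le_one h hq).trans le_self_add
  · exact (ENNReal.rpow_le_rpow_of_exponent_le h hqp).trans le_add_self

theorem LocLp.of_le (hμ : ∀ (x : X) (s : ℝ), 0 < s → μ (Metric.ball x s) < ⊤) {g : X → ℝ≥0∞}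
    (h : LocLp p μ g) (hq : 0 ≤ q) (hqp : q ≤ p) : LocLp q μ g := by
  intro x
  obtain ⟨r, hr, hi⟩ := h x
  refine ⟨r, hr, ?_⟩
  calc ∫⁻ y in Metric.ball x r, g y ^ q ∂μ ≤ ∫⁻ y in Metric.ball x r, (1 + g y ^ p) ∂μ :=
        lintegral_mono fun y => rpow_le_one_add_rpow _ hq hqp
    _ = μ (Metric.ball x r) + ∫⁻ y in Metric.ball x r, g y ^ p ∂μ := by
        rw [lintegral_add_left measurable_const, setLIntegral_const, one_mul]
    _ < ⊤ := ENNReal.add_lt_top.2 ⟨hμ x r hr, hi⟩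

/-- Lets p-weak upper gradients enter the p₀-Poincaré inequality. The same ρ witnesses the
exceptional family, since ρ^q ≤ 1 + ρ^p and balls have finite measure. -/
theorem IsWeakUpperGradient.of_le (hμ : ∀ (x : X) (s : ℝ), 0 < s → μ (Metric.ball x s) < ⊤)
    {u : X → EReal} {g : X → ℝ≥0∞} (h : IsWeakUpperGradient p μ u g) (hq : 0 ≤ q) (hqp : q ≤ p) :
    IsWeakUpperGradient q μ u g := by
  obtain ⟨h1, ρ, h2, h3, h4⟩ := h
  exact ⟨h1, ρ, h2, h3.of_le hμ hq hqp, h4⟩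

/-- The truncation of an extended real number to `[0, 1]`. -/
noncomputable def unitClamp (x : EReal) : ℝ := (max 0 (min x 1)).toReal

theorem coe_unitClamp (x : EReal) : (unitClamp x : EReal) = max 0 (min x 1) := by
  refine EReal.coe_toReal ?_ ?_
  · exact ne_of_lt ((max_le (by norm_num) (min_le_right _ _)).trans_lt (EReal.coe_lt_top 1))
  · exact ne_of_gt ((EReal.bot_lt_coe 0).trans_le (le_max_left _ _))

theorem unitClamp_nonneg (x : EReal) : 0 ≤ unitClamp x := by
  rw [← EReal.coe_nonneg, coe_unitClamp]
  exact le_max_left _ _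

theorem unitClamp_le_one (x : EReal) : unitClamp x ≤ 1 := by
  rw [← EReal.coe_le_coe_iff, coe_unitClamp]
  exact max_le (by norm_num) (min_le_right _ _)

theorem unitClamp_zero : unitClamp 0 = 0 := by
  simp [unitClamp]

theorem unitClamp_of_one_le {x : EReal} (h : 1 ≤ x) : unitClamp x = 1 := by
  simp [unitClamp, min_eq_right h]

theorem unitClamp_coe (x : ℝ) : unitClamp x = max 0 (min x 1) := by
  rw [← EReal.coe_eq_coe_iff, coe_unitClamp, EReal.coe_strictMono.monotone.map_max,
    EReal.coe_strictMono.monotone.map_min]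
  rfl

/-- Truncation is 1-Lipschitz on the reals; if x or y is infinite, the right-hand side is `⊤`, also
for ∞ - ∞. -/
theorem abs_unitClamp_sub_le (x y : EReal) :
    ENNReal.ofReal |unitClamp x - unitClamp y| ≤ (x - y).abs := by
  induction x with
  | bot => cases y <;> simp
  | top => cases y <;> simp
  | coe x =>
    induction y with
    | bot => simp
    | top => simp
    | coe y =>
      rw [abs_coe_sub_coe, unitClamp_coe, unitClamp_coe]
      refine ENNReal.ofReal_le_ofReal ?_
      refine (abs_max_sub_max_le_max _ _ _ _).trans (max_le (by simp) ?_)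
      exact (abs_min_sub_min_le_max _ _ _ _).trans (max_le le_rfl (by simp))

theorem measurable_unitClamp : Measurable unitClamp :=
  measurable_ereal_toReal.comp (measurable_const.max (measurable_id.min measurable_const))

theorem IsWeakUpperGradient.unitClamp {u : X → EReal} {g : X → ℝ≥0∞}
    (h : IsWeakUpperGradient p μ u g) :
    IsWeakUpperGradient p μ (fun x => (unitClamp (u x) : EReal)) g := by
  refine ⟨h.1, h.2.mono fun γ hγ => ?_⟩
  simp only [mem_ofPred_eq, abs_coe_sub_coe] at hγ ⊢
  exact fun h' => hγ ((abs_unitClamp_sub_le _ _).trans h')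

/-- The capacity only sees g on Ω, while the dilated balls of the Poincaré inequality may leave Ω.
If a curve meets the complement of Ω, then w vanishes at the first and at the last such time; the
change of w is thus bounded along the two end pieces, which lie in Ω. -/
theorem IsWeakUpperGradient.indicator [OpensMeasurableSpace X] {w : X → ℝ} {g : X → ℝ≥0∞}
    {Ω : Set X} (h : IsWeakUpperGradient p μ (fun x => (w x : EReal)) g) (hΩ : IsOpen Ω)
    (hw : ∀ x ∉ Ω, w x = 0) :
    IsWeakUpperGradient p μ (fun x => (w x : EReal)) (Ω.indicator g) := by
  obtain ⟨hg, ρ, hρ, hρl, hbad⟩ := h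
  refine ⟨hg.indicator hΩ.measurableSet, ρ, hρ, hρl, fun γ hγ => ?_⟩
  by_contra hfin
  apply hγ
  -- The line integral of ρ over γ is finite, hence also over every subcurve, so no subcurve is
  -- exceptional.
  have hgood : ∀ (a b : ℝ) (ha : 0 ≤ a) (hab : a < b) (hb : b ≤ γ.len),
      ENNReal.ofReal |w (γ.toFun a) - w (γ.toFun b)| ≤ ∫⁻ t in Icc a b, g (γ.toFun t) := by
    intro a b ha hab hb
    by_contra hcon
    apply hfin
    refine top_le_iff.1 ?_
    rw [← hbad (γ.subcurve ha hab hb) ?_]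
    · exact γ.lineIntegral_subcurve_le ha hab hb ρ
    · simp only [mem_ofPred_eq, abs_coe_sub_coe, RectCurve.subcurve_start, RectCurve.subcurve_end,
        RectCurve.lineIntegral_subcurve]
      exact hcon
  simp only [abs_coe_sub_coe]
  by_cases hin : ∀ t ∈ Icc 0 γ.len, γ.toFun t ∈ Ω
  · refine (hgood 0 γ.len le_rfl γ.len_pos le_rfl).trans (le_of_eq ?_)
    refine setLIntegral_congr_fun measurableSet_Icc fun t ht => ?_
    exact (indicator_of_mem (hin t ht) g).symm
  push Not at hin
  set T : Set ℝ := Icc 0 γ.len ∩ γ.toFun ⁻¹' Ωᶜ with hT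
  have hTc : IsCompact T := by
    refine IsCompact.of_isClosed_subset isCompact_Icc ?_ inter_subset_left
    exact γ.lipschitzOnWith.continuousOn.preimage_isClosed_of_isClosed isClosed_Icc
      hΩ.isClosed_compl
  have hTne : T.Nonempty := by
    obtain ⟨t, ht, ht'⟩ := hin
    exact ⟨t, ht, ht'⟩
  -- The first and the last time outside Ω; both are attained because T is compact.
  obtain ⟨s, hsT, hs⟩ := hTc.exists_isLeast hTne
  obtain ⟨e, heT, he⟩ := hTc.exists_isGreatest hTne
  have hse : s ≤ e := hs heT
  have h1 : ENNReal.ofReal |w (γ.toFun 0)| ≤ ∫⁻ t in Ico 0 s, Ω.indicator g (γ.toFun t) := by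
    rcases hsT.1.1.eq_or_lt with h0 | h0
    · rw [h0, hw _ hsT.2]; simp
    · have := hgood 0 s le_rfl h0 hsT.1.2
      rw [hw _ hsT.2, sub_zero, ← setLIntegral_congr Ico_ae_eq_Icc] at this
      refine this.trans (le_of_eq ?_)
      refine setLIntegral_congr_fun measurableSet_Ico fun t ht => ?_
      refine (indicator_of_mem ?_ g).symm
      by_contra hn
      exact absurd (hs ⟨⟨ht.1, ht.2.le.trans hsT.1.2⟩, hn⟩) (not_le.2 ht.2)
  have h2 : ENNReal.ofReal |w (γ.toFun γ.len)| ≤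
      ∫⁻ t in Ioc e γ.len, Ω.indicator g (γ.toFun t) := by
    rcases heT.1.2.eq_or_lt with h0 | h0
    · rw [← h0, hw _ heT.2]; simp
    · have := hgood e γ.len heT.1.1 h0 le_rfl
      rw [hw _ heT.2, zero_sub, abs_neg, ← setLIntegral_congr Ioc_ae_eq_Icc] at this
      refine this.trans (le_of_eq ?_)
      refine setLIntegral_congr_fun measurableSet_Ioc fun t ht => ?_
      refine (indicator_of_mem ?_ g).symm
      by_contra hn
      exact absurd (he ⟨⟨heT.1.1.trans ht.1.le, ht.2⟩, hn⟩) (not_le.2 ht.1)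
  calc ENNReal.ofReal |w (γ.toFun 0) - w (γ.toFun γ.len)|
      ≤ ENNReal.ofReal |w (γ.toFun 0)| + ENNReal.ofReal |w (γ.toFun γ.len)| := by
        rw [← ENNReal.ofReal_add (abs_nonneg _) (abs_nonneg _)]
        exact ENNReal.ofReal_le_ofReal (abs_sub _ _)
    _ ≤ _ := add_le_add h1 h2
    _ = ∫⁻ t in Ico 0 s ∪ Ioc e γ.len, Ω.indicator g (γ.toFun t) := by
        refine (lintegral_union measurableSet_Ioc ?_).symm
        refine Set.disjoint_left.2 fun t ht ht' => ?_
        exact absurd (ht.2.trans_le hse) (not_lt.2 ht'.1.le)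
    _ ≤ γ.lineIntegral (Ω.indicator g) := by
        refine lintegral_mono_set (union_subset ?_ ?_)
        · exact fun t ht => ⟨ht.1, ht.2.le.trans hsT.1.2⟩
        · exact fun t ht => ⟨heT.1.1.trans ht.1.le, ht.2⟩

end WeakUpperGradient

/-! ### The radial integral and its discretization -/

section RadialDensity

variable {X : Type*} [MetricSpace X] [MeasurableSpace X] {μ : Measure X} {x₀ : X} {α : ℝ}

/-- The density `(ρ / μ(B(x₀, ρ)))^α`. -/
noncomputable def radialDensity (μ : Measure X) (x₀ : X) (α ρ : ℝ) : ℝ≥0∞ :=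
  (ENNReal.ofReal ρ / μ (Metric.ball x₀ ρ)) ^ α

/-- The value of the scale `ρ` in a discretization of the integral of `radialDensity`. -/
noncomputable def radialTerm (μ : Measure X) (x₀ : X) (α ρ : ℝ) : ℝ≥0∞ :=
  ENNReal.ofReal ρ * radialDensity μ x₀ α ρ

theorem measurable_measure_ball (μ : Measure X) (x₀ : X) :
    Measurable fun ρ : ℝ => μ (Metric.ball x₀ ρ) :=
  Monotone.measurable fun _ _ h => measure_mono (Metric.ball_subset_ball h)

theorem measurable_radialDensity : Measurable (radialDensity μ x₀ α) :=
  (ENNReal.measurable_ofReal.div (measurable_measure_ball μ x₀)).pow_const α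

theorem le_radialDensity (hα : 0 ≤ α) {a b ρ : ℝ} (h1 : a ≤ ρ) (h2 : ρ ≤ b) :
    (ENNReal.ofReal a / μ (Metric.ball x₀ b)) ^ α ≤ radialDensity μ x₀ α ρ := by
  refine ENNReal.rpow_le_rpow ?_ hα
  exact ENNReal.div_le_div (ENNReal.ofReal_le_ofReal h1)
    (measure_mono (Metric.ball_subset_ball h2))

theorem mul_le_lintegral_radialDensity (hα : 0 ≤ α) (a b : ℝ) :
    ENNReal.ofReal (b - a) * (ENNReal.ofReal a / μ (Metric.ball x₀ b)) ^ α ≤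
      ∫⁻ ρ in Ioc a b, radialDensity μ x₀ α ρ := by
  rw [mul_comm, ← Real.volume_Ioc, ← setLIntegral_const]
  exact setLIntegral_mono measurable_radialDensity fun ρ hρ => le_radialDensity hα hρ.1.le hρ.2

theorem radialTerm_mul_le (hα : 0 ≤ α) {b c ρ : ℝ} (hb : 0 < b) (h : ρ ≤ c)
    (hc : c ≤ b * ρ) :
    radialTerm μ x₀ α c ≤ ENNReal.ofReal b ^ (1 + α) * radialTerm μ x₀ α ρ := by
  have hb0 : ENNReal.ofReal b ≠ 0 := by simpa using hb
  have hc' : ENNReal.ofReal c ≤ ENNReal.ofReal b * ENNReal.ofReal ρ := by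
    rw [← ENNReal.ofReal_mul hb.le]; exact ENNReal.ofReal_le_ofReal hc
  have h1 : radialDensity μ x₀ α c ≤ ENNReal.ofReal b ^ α * radialDensity μ x₀ α ρ := by
    unfold radialDensity
    rw [← ENNReal.mul_rpow_of_nonneg _ _ hα]
    refine ENNReal.rpow_le_rpow ?_ hα
    rw [← mul_div_assoc]
    exact ENNReal.div_le_div hc' (measure_mono (Metric.ball_subset_ball h))
  calc radialTerm μ x₀ α c
      ≤ (ENNReal.ofReal b * ENNReal.ofReal ρ) *
          (ENNReal.ofReal b ^ α * radialDensity μ x₀ α ρ) := mul_le_mul' hc' h1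
    _ = _ := by
        rw [ENNReal.rpow_add _ _ hb0 ENNReal.ofReal_ne_top, ENNReal.rpow_one, radialTerm]
        ring

/-- A term is compared with the integral over the interval just inside its radius, where the density
is at least (ρ/μ(B_{bρ}))^α. In this direction monotonicity of the measure suffices and doubling is
not needed; only the term at the inner radius r, whose interval would lie below r, requires
doubling. -/
theorem radialTerm_le_lintegral (hα : 0 ≤ α) {b ρ : ℝ} (hb : 1 < b) (hρ : 0 < ρ) :
    radialTerm μ x₀ α (b * ρ) ≤
      ENNReal.ofReal (b ^ (1 + α) / (b - 1)) *
        ∫⁻ t in Ioc ρ (b * ρ), radialDensity μ x₀ α t := by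
  have hb0 : 0 < b := by linarith
  have hb1 : 0 < b - 1 := by linarith
  refine le_trans ?_ (mul_le_mul_right (mul_le_lintegral_radialDensity hα ρ (b * ρ)) _)
  apply le_of_eq
  rw [radialTerm, radialDensity]
  have e : ENNReal.ofReal (b * ρ) / μ (Metric.ball x₀ (b * ρ)) =
      ENNReal.ofReal b * (ENNReal.ofReal ρ / μ (Metric.ball x₀ (b * ρ))) := by
    rw [ENNReal.ofReal_mul hb0.le, mul_div_assoc]
  rw [e, ENNReal.mul_rpow_of_nonneg _ _ hα, ENNReal.ofReal_rpow_of_pos hb0, ← mul_assoc,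
    ← mul_assoc, ← ENNReal.ofReal_mul (by positivity), ← ENNReal.ofReal_mul (by positivity)]
  congr 2
  rw [Real.rpow_add hb0, Real.rpow_one]
  field_simp

theorem sum_radialTerm_le_lintegral (hα : 0 ≤ α) {a b : ℝ} (hb : 1 < b) (ha : 0 < a) (n : ℕ) :
    ∑ k ∈ Finset.range n, radialTerm μ x₀ α (a * b ^ (k + 1)) ≤
      ENNReal.ofReal (b ^ (1 + α) / (b - 1)) *
        ∫⁻ t in Ioc a (a * b ^ n), radialDensity μ x₀ α t := by
  induction n with
  | zero => simp
  | succ n ih =>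
    have hpos : 0 < a * b ^ n := by positivity
    have h1 : a ≤ a * b ^ n := le_mul_of_one_le_right ha.le (one_le_pow₀ hb.le)
    have h2 : a * b ^ n ≤ a * b ^ (n + 1) := by
      rw [pow_succ, ← mul_assoc]; exact le_mul_of_one_le_right hpos.le hb.le
    rw [Finset.sum_range_succ, ← Ioc_union_Ioc_eq_Ioc h1 h2,
      lintegral_union measurableSet_Ioc (Ioc_disjoint_Ioc_of_le le_rfl), mul_add]
    refine add_le_add ih ?_
    have := radialTerm_le_lintegral (μ := μ) (x₀ := x₀) hα hb hpos
    rwa [show b * (a * b ^ n) = a * b ^ (n + 1) by ring] at this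

/-- The radial term at the inner radius is controlled by the first dyadic piece. -/
theorem radialTerm_le_of_doubling (hα : 0 ≤ α) {C r : ℝ} (hC : 0 < C)
    (hd : μ (Metric.ball x₀ (2 * r)) ≤ ENNReal.ofReal C * μ (Metric.ball x₀ r)) :
    radialTerm μ x₀ α r ≤
      ENNReal.ofReal C ^ α * ∫⁻ t in Ioc r (2 * r), radialDensity μ x₀ α t := by
  refine le_trans ?_ (mul_le_mul_right (mul_le_lintegral_radialDensity hα r (2 * r)) _)
  have hC0 : ENNReal.ofReal C ≠ 0 := by simpa using hC
  have key : ENNReal.ofReal r / μ (Metric.ball x₀ r) ≤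
      ENNReal.ofReal C * (ENNReal.ofReal r / μ (Metric.ball x₀ (2 * r))) := by
    calc ENNReal.ofReal r / μ (Metric.ball x₀ r)
        = (ENNReal.ofReal C * ENNReal.ofReal r) / (ENNReal.ofReal C * μ (Metric.ball x₀ r)) :=
          (ENNReal.mul_div_mul_left _ _ hC0 ENNReal.ofReal_ne_top).symm
      _ ≤ (ENNReal.ofReal C * ENNReal.ofReal r) / μ (Metric.ball x₀ (2 * r)) :=
          ENNReal.div_le_div_left hd _
      _ = _ := mul_div_assoc _ _ _
  rw [radialTerm, radialDensity, show 2 * r - r = r by ring, ← mul_assoc,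
    mul_comm (ENNReal.ofReal C ^ α), mul_assoc, ← ENNReal.mul_rpow_of_nonneg _ _ hα]
  exact mul_le_mul_right (ENNReal.rpow_le_rpow key hα) _

theorem radialTerm_outer_le (hα : 0 ≤ α) {R : ℝ} (hR : 0 < R) :
    radialTerm μ x₀ α R ≤
      ENNReal.ofReal (2 ^ (1 + α)) * ∫⁻ t in Ioc (R / 2) R, radialDensity μ x₀ α t := by
  have := radialTerm_le_lintegral (μ := μ) (x₀ := x₀) hα one_lt_two (half_pos hR)
  rwa [show 2 * (R / 2) = R by ring, show (2 : ℝ) - 1 = 1 by norm_num, div_one] at this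

theorem lintegral_radialDensity_pos (hα : 0 ≤ α)
    (hμ : ∀ s : ℝ, μ (Metric.ball x₀ s) < ⊤) {r R : ℝ} (hr : 0 < r)
    (hrR : r < R) : 0 < ∫⁻ t in Ioc r R, radialDensity μ x₀ α t := by
  refine lt_of_lt_of_le ?_ (mul_le_lintegral_radialDensity hα r R)
  refine ENNReal.mul_pos (by simpa using hrR) ?_
  refine (ENNReal.rpow_pos_of_nonneg ?_ hα).ne'
  exact ENNReal.div_pos (by simpa using hr) (hμ R).ne

theorem radialDensity_le (hα : 0 ≤ α) {a b ρ : ℝ} (h1 : a ≤ ρ) (h2 : ρ ≤ b) :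
    radialDensity μ x₀ α ρ ≤ (ENNReal.ofReal b / μ (Metric.ball x₀ a)) ^ α := by
  refine ENNReal.rpow_le_rpow ?_ hα
  exact ENNReal.div_le_div (ENNReal.ofReal_le_ofReal h2)
    (measure_mono (Metric.ball_subset_ball h1))

theorem div_measure_ball_rpow_lt_top (hα : 0 ≤ α) {r : ℝ} (hμ : 0 < μ (Metric.ball x₀ r))
    (R : ℝ) : (ENNReal.ofReal R / μ (Metric.ball x₀ r)) ^ α < ⊤ :=
  ENNReal.rpow_lt_top_of_nonneg hα (ENNReal.div_lt_top ENNReal.ofReal_ne_top hμ.ne').ne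

theorem lintegral_radialDensity_lt_top (hα : 0 ≤ α) {r R : ℝ}
    (hμ : 0 < μ (Metric.ball x₀ r)) :
    ∫⁻ t in Ioc r R, radialDensity μ x₀ α t < ⊤ := by
  calc ∫⁻ t in Ioc r R, radialDensity μ x₀ α t
      ≤ ∫⁻ _ in Ioc r R, (ENNReal.ofReal R / μ (Metric.ball x₀ r)) ^ α :=
        setLIntegral_mono measurable_const fun t ht => radialDensity_le hα ht.1.le ht.2
    _ < ⊤ := by
        rw [setLIntegral_const, Real.volume_Ioc]
        exact ENNReal.mul_lt_top (div_measure_ball_rpow_lt_top hα hμ R) ENNReal.ofReal_lt_top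

end RadialDensity

/-! ### Upper bound: the radial potential as a test function -/

section CapacityUpperBound

variable {X : Type*} [MetricSpace X] [MeasurableSpace X] {μ : Measure X} {x₀ : X}

theorem measurable_dist_point [OpensMeasurableSpace X] (x₀ : X) :
    Measurable fun x : X => dist x x₀ :=
  (continuous_id.dist continuous_const).measurable

theorem RectCurve.lintegral_uIoc_dist_le {X : Type*} [MetricSpace X] (γ : RectCurve X) (x₀ : X) {k : ℝ → ℝ≥0∞}
    (hk : Measurable k) :
    ∫⁻ s in uIoc (dist (γ.toFun 0) x₀) (dist (γ.toFun γ.len) x₀), k s ≤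
      γ.lineIntegral fun x => k (dist x x₀) := by
  have h : LipschitzOnWith 1 (fun t => dist (γ.toFun t) x₀) (Icc 0 γ.len) := by
    have := (LipschitzWith.dist_left x₀).comp_lipschitzOnWith γ.lipschitzOnWith
    rwa [one_mul] at this
  exact h.lintegral_uIoc_le γ.len_pos.le hk

/-- A radial function is a potential whose upper gradient is the radial derivative. -/
theorem isWeakUpperGradient_radial [OpensMeasurableSpace X] (p : ℝ) (hp : 0 < p) (μ : Measure X)
    (x₀ : X) {k : ℝ → ℝ≥0∞} (hk : Measurable k) (hfin : ∫⁻ t, k t < ⊤) :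
    IsWeakUpperGradient p μ (fun x => ((∫⁻ t in Ioi (dist x x₀), k t).toReal : EReal))
      fun x => k (dist x x₀) := by
  -- No curve is exceptional, so the zero function witnesses zero modulus.
  refine ⟨(hk.comp (measurable_dist_point x₀)).aemeasurable, fun _ => 0, measurable_const, ?_, ?_⟩
  · intro x
    refine ⟨1, one_pos, ?_⟩
    simp [ENNReal.zero_rpow_of_pos hp]
  · intro γ hγ
    refine absurd ?_ hγ
    rw [abs_coe_sub_coe]
    refine le_trans ?_ (γ.lintegral_uIoc_dist_le x₀ hk)
    have hlt : ∀ s : Set ℝ, ∫⁻ t in s, k t ≠ ⊤ := fun s =>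
      ((setLIntegral_le_lintegral s k).trans_lt hfin).ne
    have key : ∀ a b : ℝ, a ≤ b → (∫⁻ t in Ioi a, k t).toReal - (∫⁻ t in Ioi b, k t).toReal =
        (∫⁻ t in Ioc a b, k t).toReal := by
      intro a b hab
      rw [← Ioc_union_Ioi_eq_Ioi hab, lintegral_union measurableSet_Ioi
        (Set.disjoint_left.2 fun t h1 h2 => absurd h1.2 (not_le.2 h2)),
        ENNReal.toReal_add (hlt _) (hlt _)]
      ring
    rcases le_total (dist (γ.toFun 0) x₀) (dist (γ.toFun γ.len) x₀) with h | h
    · rw [key _ _ h, abs_of_nonneg ENNReal.toReal_nonneg, ENNReal.ofReal_toReal (hlt _),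
        uIoc_of_le h]
    · rw [abs_sub_comm, key _ _ h, abs_of_nonneg ENNReal.toReal_nonneg,
        ENNReal.ofReal_toReal (hlt _), uIoc_of_ge h]

theorem radialTerm_eq_rpow_mul {α ρ : ℝ} (hα : 0 ≤ α) (h0 : μ (Metric.ball x₀ ρ) ≠ 0)
    (hf : μ (Metric.ball x₀ ρ) ≠ ⊤) :
    (ENNReal.ofReal ρ / μ (Metric.ball x₀ ρ)) ^ (1 + α) * μ (Metric.ball x₀ ρ) =
      radialTerm μ x₀ α ρ := by
  rw [ENNReal.rpow_add_of_nonneg _ _ zero_le_one hα, ENNReal.rpow_one, mul_right_comm,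
    ENNReal.div_mul_cancel h0 hf]
  rfl

/-- On the dyadic annulus starting at s = r2^i the integrand is at most (2s/μ(B_s))^(1+α), and the
annulus has measure at most C μ(B_s). Its share is therefore a multiple of `radialTerm` at s, and
these terms sum to a multiple of the integral. -/
theorem lintegral_radialDensity_rpow_le [OpensMeasurableSpace X] {p C r R : ℝ} (hp : 1 < p)
    (hμ : ∀ s : ℝ, 0 < s → 0 < μ (Metric.ball x₀ s) ∧ μ (Metric.ball x₀ s) < ⊤)
    (hC : 0 < C) (hr : 0 < r) (hrR : 2 * r ≤ R)
    (hd : ∀ s : ℝ, 0 < s → s ≤ R →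
      μ (Metric.ball x₀ (2 * s)) ≤ ENNReal.ofReal C * μ (Metric.ball x₀ s)) :
    ∫⁻ x, (Ioo r R).indicator (radialDensity μ x₀ (1 / (p - 1))) (dist x x₀) ^ p ∂μ ≤
      ENNReal.ofReal C * ENNReal.ofReal 2 ^ (1 + 1 / (p - 1)) *
        (ENNReal.ofReal C ^ (1 / (p - 1)) + ENNReal.ofReal (2 ^ (1 + 1 / (p - 1)))) *
        ∫⁻ t in Ioc r R, radialDensity μ x₀ (1 / (p - 1)) t := by
  set α := 1 / (p - 1) with hα
  have hp1 : 0 < p - 1 := by linarith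
  have hα0 : 0 ≤ α := by positivity
  have hαp : α * p = 1 + α := by rw [hα]; field_simp; ring
  have hp0 : 0 ≤ p := by linarith
  obtain ⟨m, hm1, hm2⟩ := exists_nat_pow_near (x := R / r) (y := 2)
    (by rw [le_div_iff₀ hr]; linarith) one_lt_two
  rw [le_div_iff₀ hr] at hm1
  rw [div_lt_iff₀ hr] at hm2
  have hscale : ∀ i ∈ Finset.range (m + 1), r * 2 ^ i ≤ R := by
    intro i hi
    have : (2 : ℝ) ^ i ≤ 2 ^ m :=
      pow_le_pow_right₀ one_le_two (Nat.lt_succ_iff.1 (Finset.mem_range.1 hi))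
    nlinarith
  -- Each point of the annulus lies in one dyadic shell, and bounding that shell's constant on a
  -- whole ball only adds nonnegative terms.
  have hpt : ∀ x : X, (Ioo r R).indicator (radialDensity μ x₀ α) (dist x x₀) ^ p ≤
      ∑ i ∈ Finset.range (m + 1), (Metric.ball x₀ (2 * (r * 2 ^ i))).indicator
        (fun _ => (ENNReal.ofReal (2 * (r * 2 ^ i)) /
          μ (Metric.ball x₀ (r * 2 ^ i))) ^ (1 + α)) x := by
    intro x
    by_cases hx : dist x x₀ ∈ Ioo r R
    · obtain ⟨i, hi1, hi2⟩ := exists_nat_pow_near (x := dist x x₀ / r) (y := 2)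
        (by rw [le_div_iff₀ hr]; linarith [hx.1]) one_lt_two
      rw [le_div_iff₀ hr] at hi1
      rw [div_lt_iff₀ hr] at hi2
      have him : i < m + 1 := by
        have : (2 : ℝ) ^ i < 2 ^ (m + 1) := by
          have h3 : 2 ^ i * r < 2 ^ (m + 1) * r := hi1.trans_lt (hx.2.trans hm2)
          exact lt_of_mul_lt_mul_right h3 hr.le
        exact (pow_lt_pow_iff_right₀ one_lt_two).1 this
      refine le_trans ?_ (Finset.single_le_sum (fun _ _ => zero_le)
        (Finset.mem_range.2 him))
      rw [indicator_of_mem hx, indicator_of_mem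
        (by rw [Metric.mem_ball]; calc dist x x₀ < 2 ^ (i + 1) * r := hi2
              _ = _ := by ring), ← hαp, ENNReal.rpow_mul]
      refine ENNReal.rpow_le_rpow (radialDensity_le hα0 ?_ ?_) hp0
      · linarith
      · calc dist x x₀ ≤ 2 ^ (i + 1) * r := hi2.le
          _ = _ := by ring
    · rw [indicator_of_notMem hx, ENNReal.zero_rpow_of_pos (by linarith)]
      exact zero_le
  have hterm : ∀ i ∈ Finset.range (m + 1),
      ∫⁻ x, (Metric.ball x₀ (2 * (r * 2 ^ i))).indicator
        (fun _ => (ENNReal.ofReal (2 * (r * 2 ^ i)) /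
          μ (Metric.ball x₀ (r * 2 ^ i))) ^ (1 + α)) x ∂μ ≤
      ENNReal.ofReal C * ENNReal.ofReal 2 ^ (1 + α) * radialTerm μ x₀ α (r * 2 ^ i) := by
    intro i hi
    have hpos : 0 < r * 2 ^ i := by positivity
    obtain ⟨h0, hf⟩ := hμ _ hpos
    rw [lintegral_indicator_const Metric.isOpen_ball.measurableSet,
      ← radialTerm_eq_rpow_mul hα0 h0.ne' hf.ne, ENNReal.ofReal_mul zero_le_two, mul_div_assoc,
      ENNReal.mul_rpow_of_nonneg _ _ (by linarith)]
    refine (mul_le_mul_right (hd _ hpos (hscale i hi)) _).trans (le_of_eq ?_)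
    ring
  calc ∫⁻ x, (Ioo r R).indicator (radialDensity μ x₀ α) (dist x x₀) ^ p ∂μ
      ≤ ∫⁻ x, ∑ i ∈ Finset.range (m + 1), (Metric.ball x₀ (2 * (r * 2 ^ i))).indicator
        (fun _ => (ENNReal.ofReal (2 * (r * 2 ^ i)) /
          μ (Metric.ball x₀ (r * 2 ^ i))) ^ (1 + α)) x ∂μ := lintegral_mono hpt
    _ = ∑ i ∈ Finset.range (m + 1), ∫⁻ x, (Metric.ball x₀ (2 * (r * 2 ^ i))).indicator
        (fun _ => (ENNReal.ofReal (2 * (r * 2 ^ i)) /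
          μ (Metric.ball x₀ (r * 2 ^ i))) ^ (1 + α)) x ∂μ :=
        lintegral_finsetSum _ fun i _ =>
          measurable_const.indicator Metric.isOpen_ball.measurableSet
    _ ≤ ∑ i ∈ Finset.range (m + 1),
          ENNReal.ofReal C * ENNReal.ofReal 2 ^ (1 + α) * radialTerm μ x₀ α (r * 2 ^ i) :=
        Finset.sum_le_sum hterm
    _ = ENNReal.ofReal C * ENNReal.ofReal 2 ^ (1 + α) *
          (radialTerm μ x₀ α r + ∑ i ∈ Finset.range m, radialTerm μ x₀ α (r * 2 ^ (i + 1))) := by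
        rw [← Finset.mul_sum, Finset.sum_range_succ', pow_zero, mul_one,
          add_comm (Finset.sum _ _)]
    _ ≤ _ := by
        rw [mul_assoc _ (_ + _), add_mul]
        refine mul_le_mul_right (add_le_add ?_ ?_) _
        · refine (radialTerm_le_of_doubling hα0 hC (hd r hr (by linarith))).trans ?_
          exact mul_le_mul_right (lintegral_mono_set (Ioc_subset_Ioc_right hrR)) _
        · refine (sum_radialTerm_le_lintegral hα0 one_lt_two hr m).trans ?_
          rw [show (2 : ℝ) - 1 = 1 by norm_num, div_one]
          exact mul_le_mul_right
            (lintegral_mono_set (Ioc_subset_Ioc_right (by linarith))) _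

/-- The constant in the upper bound for the capacity of an annulus. -/
noncomputable def capacityUpperConst (p C : ℝ) : ℝ≥0∞ :=
  ENNReal.ofReal C * ENNReal.ofReal 2 ^ (1 + 1 / (p - 1)) *
    (ENNReal.ofReal C ^ (1 / (p - 1)) + ENNReal.ofReal (2 ^ (1 + 1 / (p - 1))))

theorem capacityUpperConst_ne_top {p C : ℝ} (hp : 1 < p) : capacityUpperConst p C ≠ ⊤ := by
  have hα : 0 ≤ 1 / (p - 1) := one_div_nonneg.2 (by linarith)
  have h1 : ENNReal.ofReal C ^ (1 / (p - 1)) ≠ ⊤ :=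
    ENNReal.rpow_ne_top_of_nonneg hα ENNReal.ofReal_ne_top
  have h2 : ENNReal.ofReal 2 ^ (1 + 1 / (p - 1)) ≠ ⊤ :=
    ENNReal.rpow_ne_top_of_nonneg (by linarith) ENNReal.ofReal_ne_top
  exact ENNReal.mul_ne_top (ENNReal.mul_ne_top ENNReal.ofReal_ne_top h2)
    (ENNReal.add_ne_top.2 ⟨h1, ENNReal.ofReal_ne_top⟩)

theorem varCap_ball_le [OpensMeasurableSpace X] {p C r R : ℝ} (hp : 1 < p)
    (hμ : ∀ s : ℝ, 0 < s → 0 < μ (Metric.ball x₀ s) ∧ μ (Metric.ball x₀ s) < ⊤)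
    (hC : 0 < C) (hr : 0 < r) (hrR : 2 * r ≤ R)
    (hd : ∀ s : ℝ, 0 < s → s ≤ R →
      μ (Metric.ball x₀ (2 * s)) ≤ ENNReal.ofReal C * μ (Metric.ball x₀ s)) :
    varCap p μ (Metric.ball x₀ r) (Metric.ball x₀ R) ≤
      capacityUpperConst p C *
        (∫⁻ t in Ioc r R, radialDensity μ x₀ (1 / (p - 1)) t) ^ (1 - p) := by
  have hE := lintegral_radialDensity_rpow_le hp hμ hC hr hrR hd
  rw [← capacityUpperConst] at hE
  set α := 1 / (p - 1) with hα
  set K := capacityUpperConst p C with hK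
  set H := ∫⁻ t in Ioc r R, radialDensity μ x₀ α t with hH
  have hp1 : 0 < p - 1 := by linarith
  have hα0 : 0 ≤ α := by positivity
  have hfin : ∀ s : ℝ, μ (Metric.ball x₀ s) < ⊤ := fun s => by
    rcases lt_or_ge 0 s with h | h
    · exact (hμ s h).2
    · simp [Metric.ball_eq_empty.2 h]
  have hH0 : H ≠ 0 := (lintegral_radialDensity_pos hα0 hfin hr (by linarith)).ne'
  have hHt : H ≠ ⊤ := (lintegral_radialDensity_lt_top hα0 (hμ r hr).1).ne
  have hKt : K ≠ ⊤ := capacityUpperConst_ne_top hp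
  -- Normalized to have integral 1, so that the tail integral of k equals 1 on B_r and vanishes
  -- outside B_R.
  set k : ℝ → ℝ≥0∞ := fun t => H⁻¹ * (Ioo r R).indicator (radialDensity μ x₀ α) t with hk
  have hkm : Measurable k :=
    (measurable_radialDensity.indicator measurableSet_Ioo).const_mul _
  have hk1 : ∫⁻ t, k t = 1 := by
    rw [lintegral_const_mul _ (measurable_radialDensity.indicator measurableSet_Ioo),
      lintegral_indicator measurableSet_Ioo, setLIntegral_congr Ioo_ae_eq_Ioc, ← hH,
      ENNReal.inv_mul_cancel hH0 hHt]
  have henergy : ∫⁻ x, k (dist x x₀) ^ p ∂μ ≤ K * H ^ (1 - p) := by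
    calc ∫⁻ x, k (dist x x₀) ^ p ∂μ
        = ∫⁻ x, H⁻¹ ^ p *
            (Ioo r R).indicator (radialDensity μ x₀ α) (dist x x₀) ^ p ∂μ := by
          refine lintegral_congr fun x => ?_
          rw [hk, ENNReal.mul_rpow_of_nonneg _ _ (by linarith)]
      _ = H⁻¹ ^ p *
            ∫⁻ x, (Ioo r R).indicator (radialDensity μ x₀ α) (dist x x₀) ^ p ∂μ :=
          lintegral_const_mul _ (((measurable_radialDensity.indicator measurableSet_Ioo).comp
            (measurable_dist_point x₀)).pow_const p)
      _ ≤ H⁻¹ ^ p * (K * H) := mul_le_mul_right hE _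
      _ = K * H ^ (1 - p) := by
          rw [sub_eq_add_neg, ENNReal.rpow_add _ _ hH0 hHt, ENNReal.rpow_one,
            ENNReal.rpow_neg, ENNReal.inv_rpow]
          ring
  have henergy_lt : ∫⁻ x, k (dist x x₀) ^ p ∂μ < ⊤ := by
    refine henergy.trans_lt (ENNReal.mul_lt_top hKt.lt_top ?_)
    exact (ENNReal.rpow_ne_top_of_ne_zero hH0 hHt).lt_top
  have hug := isWeakUpperGradient_radial p (by linarith) μ x₀ hkm
    (by rw [hk1]; exact ENNReal.one_lt_top)
  have hle1 : ∀ t : ℝ, (∫⁻ s in Ioi t, k s).toReal ≤ 1 := fun t => by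
    refine ENNReal.toReal_le_of_le_ofReal zero_le_one ?_
    rw [ENNReal.ofReal_one, ← hk1]
    exact setLIntegral_le_lintegral _ _
  have hzero : ∀ x ∉ Metric.ball x₀ R, (∫⁻ s in Ioi (dist x x₀), k s).toReal = 0 := by
    intro x hx
    rw [Metric.mem_ball, not_lt] at hx
    rw [setLIntegral_congr_fun (g := fun _ => 0) measurableSet_Ioi, lintegral_zero,
      ENNReal.toReal_zero]
    intro s hs
    simp only [hk]
    rw [indicator_of_notMem (fun h => absurd (hx.trans_lt hs) (not_lt.2 h.2.le)), mul_zero]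
  have hone : ∀ x ∈ Metric.ball x₀ r, (∫⁻ s in Ioi (dist x x₀), k s).toReal = 1 := by
    intro x hx
    rw [Metric.mem_ball] at hx
    rw [← lintegral_indicator measurableSet_Ioi, ← ENNReal.toReal_one, ← hk1]
    congr 2
    ext s
    by_cases hs : s ∈ Ioi (dist x x₀)
    · rw [indicator_of_mem hs]
    · rw [indicator_of_notMem hs, hk]
      simp only
      rw [indicator_of_notMem
        (fun h => hs (hx.trans h.1)), mul_zero]
  have hum : Measurable fun x : X => (∫⁻ s in Ioi (dist x x₀), k s).toReal := by
    have hanti : Antitone fun t : ℝ => ∫⁻ s in Ioi t, k s := fun a b hab =>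
      lintegral_mono_set (Ioi_subset_Ioi hab)
    exact (hanti.measurable.comp (measurable_dist_point x₀)).ennreal_toReal
  have hN : MemNewtonian p μ fun x => ((∫⁻ s in Ioi (dist x x₀), k s).toReal : EReal) := by
    refine ⟨(measurable_coe_real_ereal.comp hum).aemeasurable,
      ENNReal.add_lt_top.2 ⟨?_, (iInf₂_le _ hug).trans_lt henergy_lt⟩⟩
    calc ∫⁻ x, ((∫⁻ s in Ioi (dist x x₀), k s).toReal : EReal).abs ^ p ∂μ
        ≤ ∫⁻ x, (Metric.ball x₀ R).indicator (fun _ => 1) x ∂μ := by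
          refine lintegral_mono fun x => ?_
          simp only [EReal.abs_def]
          by_cases hx : x ∈ Metric.ball x₀ R
          · rw [indicator_of_mem hx, abs_of_nonneg ENNReal.toReal_nonneg]
            exact ENNReal.rpow_le_one (ENNReal.ofReal_le_one.2 (hle1 _)) (by linarith)
          · rw [hzero x hx, indicator_of_notMem hx, abs_zero, ENNReal.ofReal_zero,
              ENNReal.zero_rpow_of_pos (by linarith)]
      _ < ⊤ := by
          rw [lintegral_indicator_const Metric.isOpen_ball.measurableSet, one_mul]
          exact hfin R
  refine (iInf₂_le _ ⟨hN, fun x hx => by simp only [hzero x hx, EReal.coe_zero],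
    fun x hx => by simp only [hone x hx, EReal.coe_one, le_refl]⟩).trans ?_
  refine (iInf₂_le _ ⟨hug, fun x => ⟨1, one_pos,
    (setLIntegral_le_lintegral _ _).trans_lt henergy_lt⟩⟩).trans ?_
  exact (setLIntegral_le_lintegral _ _).trans henergy

end CapacityUpperBound

/-! ### Nested sets: a weighted Hölder inequality with bounded overlap -/

section NestedSets

variable {X : Type*} {mX : MeasurableSpace X} {μ : Measure X} {B : ℕ → Set X}

/-- The smallest measure of a set of the sequence `B` that contains `x`. -/
noncomputable def nestedMass (μ : Measure X) (B : ℕ → Set X) (x : X) : ℝ≥0∞ :=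
  ⨅ (k : ℕ) (_ : x ∈ B k), μ (B k)

theorem measurable_nestedMass (hB : ∀ k, MeasurableSet (B k)) : Measurable (nestedMass μ B) := by
  classical
  refine Measurable.iInf fun k => ?_
  have : (fun x => ⨅ (_ : x ∈ B k), μ (B k)) = fun x => if x ∈ B k then μ (B k) else ⊤ := by
    ext x
    by_cases h : x ∈ B k <;> simp [h]
  rw [this]
  exact Measurable.ite (hB k) measurable_const measurable_const

theorem nestedMass_eq (hmono : Monotone B) {x : X} {j : ℕ} (hx : x ∈ B j)
    (hj : ∀ i < j, x ∉ B i) : nestedMass μ B x = μ (B j) := by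
  refine le_antisymm (iInf₂_le j hx) (le_iInf₂ fun k hk => measure_mono (hmono ?_))
  by_contra hlt
  exact hj k (not_le.1 hlt) hk

theorem exists_nestedMass_eq (hmono : Monotone B) {x : X} {n : ℕ} (hx : x ∈ B n) :
    ∃ j ≤ n, (∀ k, x ∈ B k → j ≤ k) ∧ nestedMass μ B x = μ (B j) := by
  classical
  have hex : ∃ k, x ∈ B k := ⟨n, hx⟩
  refine ⟨Nat.find hex, Nat.find_min' hex hx, fun k hk => Nat.find_min' hex hk, ?_⟩
  exact nestedMass_eq hmono (Nat.find_spec hex) fun i hi => Nat.find_min hex hi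

/-- The left-hand increment is a lower Riemann sum for the integral of t^(-1/2) over [a, b];
algebraically it is 2√a ≤ √b + a/√b. -/
theorem two_mul_sqrt_add_le {a b : ℝ≥0∞} (ha : a ≠ 0) (hab : a ≤ b) (hb : b ≠ ⊤) :
    2 * a ^ (1 / 2 : ℝ) + b ^ (-(1 / 2) : ℝ) * (b - a) ≤ 2 * b ^ (1 / 2 : ℝ) := by
  have hat : a ≠ ⊤ := ne_top_of_le_ne_top hb hab
  have hx : 0 < a.toReal := ENNReal.toReal_pos ha hat
  have hxy : a.toReal ≤ b.toReal := ENNReal.toReal_mono hb hab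
  rw [← ENNReal.ofReal_toReal hat, ← ENNReal.ofReal_toReal hb]
  set x := a.toReal
  set y := b.toReal
  have hy : 0 < y := hx.trans_le hxy
  rw [← ENNReal.ofReal_sub _ hx.le, ENNReal.ofReal_rpow_of_pos hx, ENNReal.ofReal_rpow_of_pos hy,
    ENNReal.ofReal_rpow_of_pos hy, ← ENNReal.ofReal_mul (by positivity),
    show (2 : ℝ≥0∞) = ENNReal.ofReal 2 by simp, ← ENNReal.ofReal_mul zero_le_two,
    ← ENNReal.ofReal_mul zero_le_two,
    ← ENNReal.ofReal_add (by positivity) (mul_nonneg (by positivity) (by linarith))]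
  refine ENNReal.ofReal_le_ofReal ?_
  rw [Real.rpow_neg hy.le, ← Real.sqrt_eq_rpow, ← Real.sqrt_eq_rpow]
  have hs : 0 < √y := Real.sqrt_pos.2 hy
  have e : (√y)⁻¹ * (y - x) = √y - √x * √x / √y := by
    rw [Real.mul_self_sqrt hx.le]
    field_simp
    rw [Real.sq_sqrt hy.le]
  rw [e]
  have : 2 * √x - √x * √x / √y ≤ √y := by
    rw [sub_le_iff_le_add, ← sub_le_iff_le_add', le_div_iff₀ hs]
    nlinarith [sq_nonneg (√x - √y)]
  linarith

/-- On B (n+1) \ B n the mass equals μ(B (n+1)), so the integral is a lower Riemann sum of ∫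
t^(-1/2) dt over (0, μ(B n)). The bound uses no growth condition on the measures. -/
theorem lintegral_nestedMass_le (hB : ∀ k, MeasurableSet (B k)) (hmono : Monotone B)
    (hpos : ∀ k, μ (B k) ≠ 0) (hfin : ∀ k, μ (B k) ≠ ⊤) (n : ℕ) :
    ∫⁻ x in B n, nestedMass μ B x ^ (-(1 / 2) : ℝ) ∂μ ≤ 2 * μ (B n) ^ (1 / 2 : ℝ) := by
  induction n with
  | zero =>
    rw [setLIntegral_congr_fun (g := fun _ => μ (B 0) ^ (-(1 / 2) : ℝ)) (hB 0)
      (fun x hx => by simp only [nestedMass_eq hmono hx fun i hi => absurd hi (Nat.not_lt_zero i)]),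
      setLIntegral_const]
    nth_rewrite 2 [← ENNReal.rpow_one (μ (B 0))]
    rw [← ENNReal.rpow_add _ _ (hpos 0) (hfin 0), show -(1 / 2 : ℝ) + 1 = 1 / 2 by norm_num]
    exact le_mul_of_one_le_left zero_le one_le_two
  | succ n ih =>
    have hsub : B n ⊆ B (n + 1) := hmono (Nat.le_succ n)
    rw [← lintegral_inter_add_sdiff _ (B (n + 1)) (hB n), inter_eq_right.2 hsub,
      setLIntegral_congr_fun (g := fun _ => μ (B (n + 1)) ^ (-(1 / 2) : ℝ))
        ((hB (n + 1)).diff (hB n))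
      (fun x hx => by
        simp only [nestedMass_eq hmono hx.1
          fun i hi h => hx.2 (hmono (Nat.lt_succ_iff.1 hi) h)]),
      setLIntegral_const, measure_sdiff hsub (hB n).nullMeasurableSet (hfin n)]
    exact (add_le_add ih le_rfl).trans
      (two_mul_sqrt_add_le (hpos n) (measure_mono hsub) (hfin (n + 1)))

theorem sum_geometric_shift_le (q : ℝ≥0∞) (j n : ℕ) :
    ∑ k ∈ Finset.range n, (if j ≤ k then q ^ (k - j) else 0) ≤ (1 - q)⁻¹ := by
  rw [← Finset.sum_filter]
  have : (Finset.range n).filter (fun k => j ≤ k) = Finset.Ico j n := by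
    ext k; simp [and_comm]
  rw [this, Finset.sum_Ico_eq_sum_range]
  simp only [Nat.add_sub_cancel_left]
  rw [← ENNReal.tsum_geometric]
  exact ENNReal.sum_le_tsum _

theorem pow_mul_measure_le {C : ℝ≥0∞} {M : ℕ} (hgrow : ∀ k ≤ M, C * μ (B k) ≤ μ (B (k + 1)))
    (j i : ℕ) (h : j + i ≤ M + 1) : C ^ i * μ (B j) ≤ μ (B (j + i)) := by
  induction i with
  | zero => simp
  | succ i ih =>
    calc C ^ (i + 1) * μ (B j) = C * (C ^ i * μ (B j)) := by ring
      _ ≤ C * μ (B (j + i)) := mul_le_mul_right (ih (by omega)) _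
      _ ≤ μ (B (j + i + 1)) := hgrow _ (by omega)

/-- The weights `(nestedMass / μ (B k)) ^ δ` have bounded overlap. -/
theorem sum_nestedMass_le (hmono : Monotone B) (hpos : ∀ k, μ (B k) ≠ 0)
    (hfin : ∀ k, μ (B k) ≠ ⊤) {C D : ℝ≥0∞} (hC0 : C ≠ 0) (hCt : C ≠ ⊤) {M c : ℕ}
    (hgrow : ∀ k ≤ M, C * μ (B k) ≤ μ (B (k + 1)))
    (hdoub : ∀ i j, i ≤ M → i ≤ j + c → μ (B i) ≤ D * μ (B j)) {δ : ℝ} (hδ : 0 ≤ δ)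
    {x : X} (hx : x ∈ B M) :
    ∑ k ∈ Finset.range (M + 1), (B (k + 1 + c)).indicator
        (fun x => μ (B (k + 1)) ^ (-δ) * nestedMass μ B x ^ δ) x ≤
      D ^ δ * (1 - C⁻¹ ^ δ)⁻¹ := by
  obtain ⟨J, hJM, hJ, hmass⟩ := exists_nestedMass_eq (μ := μ) hmono hx
  -- Adding the nonnegative term of index 0 removes the index shift.
  calc ∑ k ∈ Finset.range (M + 1), (B (k + 1 + c)).indicator
        (fun x => μ (B (k + 1)) ^ (-δ) * nestedMass μ B x ^ δ) x
      ≤ ∑ k ∈ Finset.range (M + 2), (B (k + c)).indicator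
        (fun x => μ (B k) ^ (-δ) * nestedMass μ B x ^ δ) x := by
        rw [Finset.sum_range_succ' _ (M + 1)]
        exact le_self_add
    _ ≤ ∑ k ∈ Finset.range (M + 2), D ^ δ * (if J - c ≤ k then (C⁻¹ ^ δ) ^ (k - (J - c)) else 0) := by
        refine Finset.sum_le_sum fun k hk => ?_
        by_cases hxk : x ∈ B (k + c)
        · have hJk : J ≤ k + c := hJ _ hxk
          have hle : J - c ≤ k := by omega
          have hkM : k ≤ M + 1 := Nat.lt_succ_iff.1 (Finset.mem_range.1 hk)
          rw [indicator_of_mem hxk, if_pos hle, hmass, ENNReal.rpow_neg, ← ENNReal.inv_rpow,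
            ← ENNReal.mul_rpow_of_nonneg _ _ hδ, ← ENNReal.rpow_natCast, ← ENNReal.rpow_mul,
            mul_comm δ, ENNReal.rpow_mul, ENNReal.rpow_natCast,
            ← ENNReal.mul_rpow_of_nonneg _ _ hδ]
          refine ENNReal.rpow_le_rpow ?_ hδ
          -- Growth is iterated from J - c, the first index that can contribute; doubling returns
          -- from there to J at the cost of one factor D. The subtraction is truncated at 0, which
          -- is harmless as J ≤ (J - c) + c always holds.
          have h1 := pow_mul_measure_le hgrow (J - c) (k - (J - c)) (by omega)
          rw [show J - c + (k - (J - c)) = k by omega] at h1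
          have h2 := hdoub J (J - c) hJM (by omega)
          have h3 : μ (B (J - c)) ≤ C⁻¹ ^ (k - (J - c)) * μ (B k) := by
            rw [← ENNReal.inv_pow]
            rw [mul_comm, ← div_eq_mul_inv, ENNReal.le_div_iff_mul_le
              (Or.inl (pow_ne_zero _ hC0)) (Or.inl (ENNReal.pow_ne_top hCt)), mul_comm]
            exact h1
          calc (μ (B k))⁻¹ * μ (B J)
              ≤ (μ (B k))⁻¹ * (D * (C⁻¹ ^ (k - (J - c)) * μ (B k))) :=
                mul_le_mul_right (h2.trans (mul_le_mul_right h3 _)) _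
            _ = D * C⁻¹ ^ (k - (J - c)) * ((μ (B k))⁻¹ * μ (B k)) := by ring
            _ = D * C⁻¹ ^ (k - (J - c)) := by
                rw [ENNReal.inv_mul_cancel (hpos k) (hfin k), mul_one]
        · rw [indicator_of_notMem hxk]
          exact zero_le
    _ ≤ D ^ δ * (1 - C⁻¹ ^ δ)⁻¹ := by
        rw [← Finset.mul_sum]
        exact mul_le_mul_right (sum_geometric_shift_le _ _ _) _

/-- Hölder's inequality with the weight `M`. -/
theorem lintegral_rpow_le_weighted {ν : Measure X} {p q : ℝ} (hq : 0 < q) (hqp : q < p)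
    {g M : X → ℝ≥0∞} (hg : AEMeasurable g ν) (hM : AEMeasurable M ν)
    (hM0 : ∀ᵐ x ∂ν, M x ≠ 0) (hMt : ∀ᵐ x ∂ν, M x ≠ ⊤) :
    ∫⁻ x, g x ^ q ∂ν ≤ (∫⁻ x, g x ^ p * M x ^ ((p - q) / (2 * q)) ∂ν) ^ (q / p) *
      (∫⁻ x, M x ^ (-(1 / 2) : ℝ) ∂ν) ^ (1 - q / p) := by
  have hp : 0 < p := hq.trans hqp
  have hpq : 0 < p - q := sub_pos.2 hqp
  have hconj : (p / q).HolderConjugate (p / (p - q)) := by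
    rw [Real.holderConjugate_iff]
    refine ⟨(one_lt_div hq).2 hqp, ?_⟩
    field_simp
    ring
  -- The power (p-q)/(2p) of M is chosen so that the conjugate exponent p/(p-q) turns the second
  -- factor into M^(-1/2).
  have h := ENNReal.lintegral_mul_le_Lp_mul_Lq ν hconj
    (f := fun x => g x ^ q * M x ^ ((p - q) / (2 * p))) (g := fun x => M x ^ (-((p - q) / (2 * p))))
    ((hg.pow_const _).mul (hM.pow_const _)) (hM.pow_const _)
  have e1 : ∫⁻ x, g x ^ q ∂ν = ∫⁻ x, ((fun x => g x ^ q * M x ^ ((p - q) / (2 * p))) *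
      fun x => M x ^ (-((p - q) / (2 * p)))) x ∂ν := by
    refine lintegral_congr_ae ?_
    filter_upwards [hM0, hMt] with x h0 ht
    rw [Pi.mul_apply, mul_assoc, ← ENNReal.rpow_add _ _ h0 ht, add_neg_cancel, ENNReal.rpow_zero,
      mul_one]
  rw [e1]
  refine h.trans (le_of_eq ?_)
  congr 1
  · rw [one_div_div]
    congr 1
    refine lintegral_congr fun x => ?_
    rw [ENNReal.mul_rpow_of_nonneg _ _ (by positivity), ← ENNReal.rpow_mul, ← ENNReal.rpow_mul]
    congr 2
    · field_simp
    · field_simp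
  · rw [one_div_div, show (p - q) / p = 1 - q / p by field_simp]
    congr 1
    refine lintegral_congr fun x => ?_
    rw [← ENNReal.rpow_mul]
    congr 1
    field_simp

/-- Exponent bookkeeping: the powers of m combine through (1/q - 1/p)/2 - 1/q = -1/p - δ/p with δ =
(p-q)/(2q). This separates the factor m^(-δ) that makes the weights decay. -/
theorem rpow_mean_le {p q : ℝ} (hq : 0 < q) (hqp : q < p) {m D I T : ℝ≥0∞} (h0 : m ≠ 0)
    (ht : m ≠ ⊤)
    (hI : I ≤ T ^ (q / p) * (2 * (D * m) ^ (1 / 2 : ℝ)) ^ (1 - q / p)) :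
    (I / m) ^ (1 / q) ≤ (2 * D ^ (1 / 2 : ℝ)) ^ (1 / q - 1 / p) *
      (m ^ (-(1 / p)) * (m ^ (-((p - q) / (2 * q))) * T) ^ (1 / p)) := by
  have hp : 0 < p := hq.trans hqp
  have hqp1 : 0 ≤ 1 - q / p := by
    rw [sub_nonneg, div_le_one hp]; exact hqp.le
  have e : 1 / q - 1 / p = (1 - q / p) * (1 / q) := by field_simp
  have he : 0 ≤ 1 / q - 1 / p := by rw [e]; positivity
  calc (I / m) ^ (1 / q)
      ≤ (T ^ (q / p) * (2 * (D * m) ^ (1 / 2 : ℝ)) ^ (1 - q / p) / m) ^ (1 / q) :=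
        ENNReal.rpow_le_rpow (ENNReal.div_le_div_right hI _) (by positivity)
    _ = T ^ (1 / p) * (2 * D ^ (1 / 2 : ℝ) * m ^ (1 / 2 : ℝ)) ^ (1 / q - 1 / p) *
          m ^ (-(1 / q)) := by
        rw [div_eq_mul_inv, ENNReal.mul_rpow_of_nonneg _ _ (by positivity),
          ENNReal.mul_rpow_of_nonneg _ _ (by positivity), ← ENNReal.rpow_mul, ← ENNReal.rpow_mul,
          ← e, ENNReal.inv_rpow, ← ENNReal.rpow_neg,
          ENNReal.mul_rpow_of_nonneg D m (by norm_num), mul_assoc 2,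
          show q / p * (1 / q) = 1 / p by field_simp]
    _ = (2 * D ^ (1 / 2 : ℝ)) ^ (1 / q - 1 / p) *
          (m ^ ((1 / 2) * (1 / q - 1 / p) + -(1 / q)) * T ^ (1 / p)) := by
        rw [ENNReal.mul_rpow_of_nonneg _ _ he, ← ENNReal.rpow_mul m, ENNReal.rpow_add _ _ h0 ht]
        ring
    _ = _ := by
        rw [ENNReal.mul_rpow_of_nonneg _ _ (by positivity : 0 ≤ 1 / p), ← ENNReal.rpow_mul m,
          ← mul_assoc (m ^ (-(1 / p))), ← ENNReal.rpow_add _ _ h0 ht,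
          show 1 / 2 * (1 / q - 1 / p) + -(1 / q) =
            -(1 / p) + -((p - q) / (2 * q)) * (1 / p) by field_simp; ring]

/-- Identifies the first factor in Hölder's inequality for sums with the terms of the discretized
radial integral. -/
theorem mul_rpow_conj_eq {p : ℝ} (hp : 1 < p) {a m : ℝ≥0∞} :
    (a * m ^ (-(1 / p))) ^ (p / (p - 1)) = a * (a / m) ^ (1 / (p - 1)) := by
  have hp1 : 0 < p - 1 := by linarith
  rw [ENNReal.mul_rpow_of_nonneg _ _ (by positivity), ← ENNReal.rpow_mul,
    show p / (p - 1) = 1 + 1 / (p - 1) by field_simp; ring,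
    ENNReal.rpow_add_of_nonneg _ _ zero_le_one (by positivity), ENNReal.rpow_one,
    ENNReal.div_rpow_of_nonneg _ _ (by positivity), mul_assoc,
    div_eq_mul_inv (a ^ (1 / (p - 1))), ← ENNReal.rpow_neg]
  congr 3
  field_simp
  ring

/-- The sum of `q`-means over dilated nested sets is controlled by the `p`-energy, `q < p`. -/
theorem sum_mul_rpow_mean_le (hB : ∀ k, MeasurableSet (B k)) (hmono : Monotone B)
    (hpos : ∀ k, μ (B k) ≠ 0) (hfin : ∀ k, μ (B k) ≠ ⊤) {C D : ℝ≥0∞} (hC0 : C ≠ 0)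
    (hCt : C ≠ ⊤) {M c : ℕ} (hgrow : ∀ k ≤ M, C * μ (B k) ≤ μ (B (k + 1)))
    (hdoub : ∀ i j, i ≤ M → i ≤ j + c → μ (B i) ≤ D * μ (B j)) {p q : ℝ} (hq : 0 < q)
    (hqp : q < p) (hp : 1 < p) {g : X → ℝ≥0∞} (hg : AEMeasurable g μ)
    (hg0 : ∀ x ∉ B M, g x = 0) (ρ : ℕ → ℝ≥0∞) :
    ∑ k ∈ Finset.range (M + 1),
        ρ (k + 1) * ((∫⁻ x in B (k + 1 + c), g x ^ q ∂μ) / μ (B (k + 1))) ^ (1 / q) ≤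
      (2 * D ^ (1 / 2 : ℝ)) ^ (1 / q - 1 / p) *
        ((∑ k ∈ Finset.range (M + 1),
            ρ (k + 1) * (ρ (k + 1) / μ (B (k + 1))) ^ (1 / (p - 1))) ^ ((p - 1) / p) *
          (D ^ ((p - q) / (2 * q)) * (1 - C⁻¹ ^ ((p - q) / (2 * q)))⁻¹ *
            ∫⁻ x in B M, g x ^ p ∂μ) ^ (1 / p)) := by
  have hp0 : 0 < p := by linarith
  have hp1 : 0 < p - 1 := by linarith
  set δ := (p - q) / (2 * q) with hδ
  have hδ0 : 0 ≤ δ := div_nonneg (by linarith) (by linarith)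
  set W := nestedMass μ B with hW
  have hWm : Measurable W := measurable_nestedMass hB
  have hWx : ∀ n, ∀ x ∈ B n, W x ≠ 0 ∧ W x ≠ ⊤ := by
    intro n x hx
    obtain ⟨j, -, -, hj⟩ := exists_nestedMass_eq (μ := μ) hmono hx
    rw [hW, hj]
    exact ⟨hpos j, hfin j⟩
  -- Doubling is available only for sets of index at most M. Since g vanishes outside B M, larger
  -- dilated sets may be replaced by B M.
  have hcut : ∀ (f : X → ℝ≥0∞) (n : ℕ), (∀ x ∉ B M, f x = 0) →
      ∫⁻ x in B n, f x ∂μ = ∫⁻ x in B (min n M), f x ∂μ := by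
    intro f n hf
    have h1 : B (min n M) = B n ∩ B M := by
      rcases le_total n M with h | h
      · rw [min_eq_left h, inter_eq_left.2 (hmono h)]
      · rw [min_eq_right h, inter_eq_right.2 (hmono h)]
    rw [h1, ← lintegral_inter_add_sdiff f (B n) (hB M),
      setLIntegral_congr_fun (g := fun _ => 0) ((hB n).diff (hB M)) (fun x hx => hf x hx.2)]
    simp
  set T : ℕ → ℝ≥0∞ := fun k => ∫⁻ x in B (k + c), g x ^ p * W x ^ δ ∂μ with hT
  have hmean : ∀ k, ((∫⁻ x in B (k + c), g x ^ q ∂μ) / μ (B k)) ^ (1 / q) ≤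
      (2 * D ^ (1 / 2 : ℝ)) ^ (1 / q - 1 / p) *
        (μ (B k) ^ (-(1 / p)) * (μ (B k) ^ (-δ) * T k) ^ (1 / p)) := by
    intro k
    refine rpow_mean_le hq hqp (hpos k) (hfin k) ?_
    rw [hT]
    simp only
    rw [hcut _ (k + c) (fun x hx => by rw [hg0 x hx, ENNReal.zero_rpow_of_pos hq]),
      hcut _ (k + c) (fun x hx => by rw [hg0 x hx, ENNReal.zero_rpow_of_pos hp0, zero_mul])]
    refine (lintegral_rpow_le_weighted hq hqp hg.restrict hWm.aemeasurable ?_ ?_).trans ?_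
    · exact (ae_restrict_iff' (hB _)).2 (Filter.Eventually.of_forall fun x hx => (hWx _ x hx).1)
    · exact (ae_restrict_iff' (hB _)).2 (Filter.Eventually.of_forall fun x hx => (hWx _ x hx).2)
    · refine mul_le_mul_right (ENNReal.rpow_le_rpow ?_ ?_) _
      · refine (lintegral_nestedMass_le hB hmono hpos hfin _).trans ?_
        refine mul_le_mul_right (ENNReal.rpow_le_rpow ?_ (by norm_num)) _
        exact hdoub _ _ (min_le_right _ _) (min_le_left _ _)
      · rw [sub_nonneg, div_le_one hp0]; exact hqp.le
  have hconj : (p / (p - 1)).HolderConjugate p := by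
    rw [Real.holderConjugate_iff]
    refine ⟨(one_lt_div hp1).2 (by linarith), ?_⟩
    field_simp
    ring
  -- Summing under the integral sign leaves g^p times the overlap sum of the weights, bounded
  -- pointwise on B M.
  have hover : ∑ k ∈ Finset.range (M + 1), μ (B (k + 1)) ^ (-δ) * T (k + 1) ≤
      D ^ δ * (1 - C⁻¹ ^ δ)⁻¹ * ∫⁻ x in B M, g x ^ p ∂μ := by
    have hmeas : AEMeasurable (fun x => g x ^ p) (μ.restrict (B M)) := hg.restrict.pow_const p
    have hind : ∀ k, Measurable ((B (k + 1 + c)).indicator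
        fun x => μ (B (k + 1)) ^ (-δ) * W x ^ δ) := fun k =>
      ((hWm.pow_const δ).const_mul _).indicator (hB _)
    have hterm : ∀ k, μ (B (k + 1)) ^ (-δ) * T (k + 1) = ∫⁻ x in B M, g x ^ p *
        (B (k + 1 + c)).indicator (fun x => μ (B (k + 1)) ^ (-δ) * W x ^ δ) x ∂μ := by
      intro k
      have hcongr : (fun x => g x ^ p *
          (B (k + 1 + c)).indicator (fun x => μ (B (k + 1)) ^ (-δ) * W x ^ δ) x) =
          (B (k + 1 + c)).indicator
            (fun x => μ (B (k + 1)) ^ (-δ) * (g x ^ p * W x ^ δ)) := by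
        ext x
        by_cases hx : x ∈ B (k + 1 + c)
        · rw [indicator_of_mem hx, indicator_of_mem hx]; ring
        · rw [indicator_of_notMem hx, indicator_of_notMem hx, mul_zero]
      rw [hcongr, setLIntegral_indicator (hB _), hT]
      simp only
      have hprod : AEMeasurable (fun x => g x ^ p * W x ^ δ)
          (μ.restrict (B (k + 1 + c) ∩ B M)) :=
        (hg.restrict.pow_const p).mul (hWm.aemeasurable.pow_const δ)
      rw [lintegral_const_mul'' _ hprod,
        hcut _ (k + 1 + c) (fun x hx => by rw [hg0 x hx, ENNReal.zero_rpow_of_pos hp0, zero_mul])]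
      congr 3
      rcases le_total (k + 1 + c) M with h | h
      · rw [min_eq_left h, inter_eq_left.2 (hmono h)]
      · rw [min_eq_right h, inter_eq_right.2 (hmono h)]
    have hprod : ∀ k ∈ Finset.range (M + 1), AEMeasurable (fun x => g x ^ p *
        (B (k + 1 + c)).indicator (fun x => μ (B (k + 1)) ^ (-δ) * W x ^ δ) x)
          (μ.restrict (B M)) := fun k _ => hmeas.mul (hind k).aemeasurable
    rw [Finset.sum_congr rfl fun k _ => hterm k, ← lintegral_finsetSum' _ hprod,
      ← lintegral_const_mul'' _ hmeas]
    refine setLIntegral_mono_ae' (hB M) (Filter.Eventually.of_forall fun x hx => ?_)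
    rw [← Finset.mul_sum, mul_comm (g x ^ p)]
    exact mul_le_mul_left
      (sum_nestedMass_le hmono hpos hfin hC0 hCt hgrow hdoub hδ0 hx) _
  calc ∑ k ∈ Finset.range (M + 1),
        ρ (k + 1) * ((∫⁻ x in B (k + 1 + c), g x ^ q ∂μ) / μ (B (k + 1))) ^ (1 / q)
      ≤ ∑ k ∈ Finset.range (M + 1), (2 * D ^ (1 / 2 : ℝ)) ^ (1 / q - 1 / p) *
        ((ρ (k + 1) * μ (B (k + 1)) ^ (-(1 / p))) *
          (μ (B (k + 1)) ^ (-δ) * T (k + 1)) ^ (1 / p)) := by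
        refine Finset.sum_le_sum fun k _ => ?_
        refine (mul_le_mul_right (hmean (k + 1)) _).trans (le_of_eq ?_)
        ring
    _ ≤ _ := by
        rw [← Finset.mul_sum]
        refine mul_le_mul_right ?_ _
        refine (ENNReal.inner_le_Lp_mul_Lq _ _ _ hconj).trans ?_
        simp only [mul_rpow_conj_eq hp, one_div_div]
        refine mul_le_mul_right (ENNReal.rpow_le_rpow ?_ (by positivity)) _
        simp only [← ENNReal.rpow_mul]
        rw [one_div_mul_cancel hp0.ne']
        simpa only [ENNReal.rpow_one] using hover

end NestedSets

/-! ### Telescoping of mean values -/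

section Chain

variable {X : Type*} [MeasurableSpace X] {μ : Measure X}

theorem ofReal_average_le {A B : Set X} (hAB : A ⊆ B) (hA : μ A ≠ 0) (hBt : μ B ≠ ⊤) {L : ℝ≥0∞}
    (hL : μ B ≤ L * μ A) {w : X → ℝ} (hw : AEMeasurable w μ) (hw0 : ∀ x, 0 ≤ w x)
    (hw1 : ∀ x, w x ≤ 1) (c : ℝ) :
    ENNReal.ofReal (⨍ x in A, w x ∂μ) ≤
      ENNReal.ofReal c + L * ⨍⁻ x in B, ENNReal.ofReal |w x - c| ∂μ := by
  have hAt : μ A ≠ ⊤ := ne_top_of_le_ne_top hBt (measure_mono hAB)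
  have hint : IntegrableOn w A μ := by
    refine Measure.integrableOn_of_bounded (M := 1) hAt hw.aestronglyMeasurable ?_
    refine Filter.Eventually.of_forall fun x => ?_
    rw [Real.norm_eq_abs, abs_of_nonneg (hw0 x)]
    exact hw1 x
  rw [ofReal_setAverage hint (Filter.Eventually.of_forall hw0), setLAverage_eq]
  have h1 : ∫⁻ x in A, ENNReal.ofReal (w x) ∂μ ≤
      ENNReal.ofReal c * μ A + ∫⁻ x in B, ENNReal.ofReal |w x - c| ∂μ := by
    calc ∫⁻ x in A, ENNReal.ofReal (w x) ∂μ
        ≤ ∫⁻ x in A, (ENNReal.ofReal c + ENNReal.ofReal |w x - c|) ∂μ := by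
          refine lintegral_mono fun x => ?_
          refine le_trans (ENNReal.ofReal_le_ofReal ?_) ENNReal.ofReal_add_le
          linarith [le_abs_self (w x - c)]
      _ = ENNReal.ofReal c * μ A + ∫⁻ x in A, ENNReal.ofReal |w x - c| ∂μ := by
          rw [lintegral_add_left measurable_const, setLIntegral_const]
      _ ≤ _ := add_le_add le_rfl (lintegral_mono_set hAB)
  refine (ENNReal.div_le_div_right h1 _).trans ?_
  rw [ENNReal.add_div, mul_div_assoc, ENNReal.div_self hA hAt, mul_one]
  refine add_le_add le_rfl ?_
  rw [ENNReal.div_le_iff hA hAt]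
  have hB0 : μ B ≠ 0 := fun h => hA (measure_mono_null hAB h)
  set I := ∫⁻ x in B, ENNReal.ofReal |w x - c| ∂μ
  calc I = I / μ B * μ B := (ENNReal.div_mul_cancel hB0 hBt).symm
    _ ≤ I / μ B * (L * μ A) := mul_le_mul_right hL _
    _ = L * (I / μ B) * μ A := by ring

/-- On D the oscillation |w - c| equals |c|, and D fills a fixed fraction of B. This ends the chain:
c is the last mean and D the part of the last ball where w vanishes. -/
theorem ofReal_le_mul_laverage {B D : Set X} (hD : MeasurableSet D) (hDB : D ⊆ B) (hB0 : μ B ≠ 0)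
    (hBt : μ B ≠ ⊤) {K : ℝ≥0∞} (hK : μ B ≤ K * μ D) {w : X → ℝ}
    (hw : ∀ x ∈ D, w x = 0) (c : ℝ) :
    ENNReal.ofReal c ≤ K * ⨍⁻ x in B, ENNReal.ofReal |w x - c| ∂μ := by
  rw [setLAverage_eq, ← mul_div_assoc, ENNReal.le_div_iff_mul_le (Or.inl hB0) (Or.inl hBt)]
  calc ENNReal.ofReal c * μ B ≤ ENNReal.ofReal c * (K * μ D) := mul_le_mul_right hK _
    _ = K * (ENNReal.ofReal c * μ D) := by ring
    _ ≤ K * ∫⁻ x in B, ENNReal.ofReal |w x - c| ∂μ := by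
        refine mul_le_mul_right ?_ _
        calc ENNReal.ofReal c * μ D = ∫⁻ _ in D, ENNReal.ofReal c ∂μ := (setLIntegral_const _ _).symm
          _ ≤ ∫⁻ x in D, ENNReal.ofReal |w x - c| ∂μ := by
              refine setLIntegral_mono' hD fun x hx => ?_
              rw [hw x hx, zero_sub, abs_neg]
              exact ENNReal.ofReal_le_ofReal (le_abs_self c)
          _ ≤ _ := lintegral_mono_set hDB

theorem measure_le_mul_measure_sdiff {A B : Set X} (hA : MeasurableSet A) (hAB : A ⊆ B)
    (hBt : μ B ≠ ⊤) {C : ℝ} (hC : 1 < C) (h : ENNReal.ofReal C * μ A ≤ μ B) :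
    μ B ≤ ENNReal.ofReal (C / (C - 1)) * μ (B \ A) := by
  have hAt : μ A ≠ ⊤ := ne_top_of_le_ne_top hBt (measure_mono hAB)
  have hC1 : 0 < C - 1 := by linarith
  rw [measure_sdiff hAB hA.nullMeasurableSet hAt]
  have h' : C * (μ A).toReal ≤ (μ B).toReal := by
    have := ENNReal.toReal_mono hBt h
    rwa [ENNReal.toReal_mul, ENNReal.toReal_ofReal (by linarith)] at this
  rw [← ENNReal.ofReal_toReal hAt, ← ENNReal.ofReal_toReal hBt,
    ← ENNReal.ofReal_sub _ ENNReal.toReal_nonneg, ← ENNReal.ofReal_mul (by positivity)]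
  refine ENNReal.ofReal_le_ofReal ?_
  rw [div_mul_eq_mul_div, le_div_iff₀ hC1]
  linarith

/-- Telescoping along a nested sequence of sets, from a set where `w = 1` to one a large part of
which lies in `{w = 0}`. -/
theorem one_le_mul_sum_laverage {B : ℕ → Set X} (hB : ∀ k, MeasurableSet (B k)) (hmono : Monotone B)
    (hpos : ∀ k, μ (B k) ≠ 0) (hfin : ∀ k, μ (B k) ≠ ⊤) {C : ℝ} (hC : 1 < C) {D : ℝ≥0∞} {M : ℕ}
    (hgrow : ENNReal.ofReal C * μ (B M) ≤ μ (B (M + 1)))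
    (hdoub : ∀ k ≤ M, μ (B (k + 1)) ≤ D * μ (B k)) {w : X → ℝ} (hw : AEMeasurable w μ)
    (hw0 : ∀ x, 0 ≤ w x) (hw1 : ∀ x, w x ≤ 1) (hone : ∀ x ∈ B 0, w x = 1)
    (hzero : ∀ x ∉ B M, w x = 0) :
    1 ≤ (ENNReal.ofReal (C / (C - 1)) + D) * ∑ k ∈ Finset.range (M + 1),
      ⨍⁻ x in B (k + 1), ENNReal.ofReal |w x - ⨍ y in B (k + 1), w y ∂μ| ∂μ := by
  set a : ℕ → ℝ := fun k => ⨍ y in B k, w y ∂μ with ha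
  set P : ℕ → ℝ≥0∞ := fun k => ⨍⁻ x in B k, ENNReal.ofReal |w x - a k| ∂μ with hP
  have ha0 : a 0 = 1 := by
    simp only [ha]
    rw [setAverage_eq, setIntegral_congr_fun (g := fun _ => 1) (hB 0) hone, setIntegral_const,
      smul_eq_mul, smul_eq_mul, mul_one, inv_mul_cancel₀]
    exact (ENNReal.toReal_pos (hpos 0) (hfin 0)).ne'
  -- Passing from the mean over B n to that over B (n+1) costs the oscillation on B (n+1) times the
  -- doubling constant.
  have hstep : ∀ n ≤ M + 1, ENNReal.ofReal (a 0) ≤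
      ENNReal.ofReal (a n) + D * ∑ k ∈ Finset.range n, P (k + 1) := by
    intro n
    induction n with
    | zero => simp
    | succ n ih =>
      intro hn
      have h1 := ofReal_average_le (hmono (Nat.le_succ n)) (hpos n) (hfin (n + 1))
        (hdoub n (by omega)) hw hw0 hw1 (a (n + 1))
      calc ENNReal.ofReal (a 0) ≤ ENNReal.ofReal (a n) + D * ∑ k ∈ Finset.range n, P (k + 1) :=
            ih (by omega)
        _ ≤ (ENNReal.ofReal (a (n + 1)) + D * P (n + 1)) +
              D * ∑ k ∈ Finset.range n, P (k + 1) := add_le_add h1 le_rfl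
        _ = _ := by rw [Finset.sum_range_succ]; ring
  have hlast : ENNReal.ofReal (a (M + 1)) ≤ ENNReal.ofReal (C / (C - 1)) * P (M + 1) :=
    ofReal_le_mul_laverage ((hB (M + 1)).diff (hB M)) sdiff_subset (hpos _) (hfin _)
      (measure_le_mul_measure_sdiff (hB M) (hmono (Nat.le_succ M)) (hfin _) hC hgrow)
      (fun x hx => hzero x hx.2) _
  calc (1 : ℝ≥0∞) = ENNReal.ofReal (a 0) := by rw [ha0, ENNReal.ofReal_one]
    _ ≤ ENNReal.ofReal (a (M + 1)) + D * ∑ k ∈ Finset.range (M + 1), P (k + 1) :=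
        hstep _ le_rfl
    _ ≤ ENNReal.ofReal (C / (C - 1)) * ∑ k ∈ Finset.range (M + 1), P (k + 1) +
          D * ∑ k ∈ Finset.range (M + 1), P (k + 1) := by
        refine add_le_add (hlast.trans (mul_le_mul_right ?_ _)) le_rfl
        exact Finset.single_le_sum (f := fun k => P (k + 1)) (fun _ _ => zero_le)
          (Finset.self_mem_range_succ M)
    _ = _ := by rw [← add_mul]

end Chain

/-! ### Lower bound: chaining, Poincaré and Hölder -/

section CapacityLowerBound

variable {X : Type*} [MetricSpace X] [MeasurableSpace X] {μ : Measure X} {x₀ : X}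

theorem measure_ball_le_of_doubling {C T : ℝ}
    (hd : ∀ s : ℝ, 0 < s → 2 * s ≤ T →
      μ (Metric.ball x₀ (2 * s)) ≤ ENNReal.ofReal C * μ (Metric.ball x₀ s))
    (n : ℕ) {s t : ℝ} (ht0 : 0 < t) (ht : t ≤ T) (hts : t ≤ 2 ^ n * s) :
    μ (Metric.ball x₀ t) ≤ ENNReal.ofReal C ^ n * μ (Metric.ball x₀ s) := by
  induction n generalizing t with
  | zero =>
    rw [pow_zero, one_mul] at hts ⊢
    exact measure_mono (Metric.ball_subset_ball hts)
  | succ n ih =>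
    have h1 := hd (t / 2) (half_pos ht0) (by linarith)
    rw [show 2 * (t / 2) = t by ring] at h1
    have h2 := ih (half_pos ht0) (by linarith) (by rw [pow_succ] at hts; linarith)
    calc μ (Metric.ball x₀ t) ≤ ENNReal.ofReal C * μ (Metric.ball x₀ (t / 2)) := h1
      _ ≤ ENNReal.ofReal C * (ENNReal.ofReal C ^ n * μ (Metric.ball x₀ s)) :=
          mul_le_mul_right h2 _
      _ = _ := by ring

/-- The constant in the estimate of the radial terms along a geometric sequence. -/
noncomputable def radialSumConst (α ξ C : ℝ) : ℝ≥0∞ :=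
  ENNReal.ofReal ξ ^ (1 + α) * ENNReal.ofReal C ^ α +
    ENNReal.ofReal (ξ ^ (1 + α) / (ξ - 1)) +
    ENNReal.ofReal ξ ^ (1 + α) * ENNReal.ofReal (2 ^ (1 + α))

theorem radialSumConst_ne_top {α ξ C : ℝ} (hα : 0 ≤ α) : radialSumConst α ξ C ≠ ⊤ := by
  have h1 : ENNReal.ofReal ξ ^ (1 + α) ≠ ⊤ :=
    ENNReal.rpow_ne_top_of_nonneg (by linarith) ENNReal.ofReal_ne_top
  have h2 : ENNReal.ofReal C ^ α ≠ ⊤ := ENNReal.rpow_ne_top_of_nonneg hα ENNReal.ofReal_ne_top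
  exact ENNReal.add_ne_top.2 ⟨ENNReal.add_ne_top.2 ⟨ENNReal.mul_ne_top h1 h2,
    ENNReal.ofReal_ne_top⟩, ENNReal.mul_ne_top h1 ENNReal.ofReal_ne_top⟩

/-- The radii run from ξa, which lies in [r, ξr], up to ξR. The first term is compared with the one
at r, the last with the one at R, and the others with the integral over the intervals just inside
them; this gives the three summands of the constant. -/
theorem sum_radialTerm_le {α ξ C a r R : ℝ} (hα : 0 ≤ α) (hξ : 1 < ξ) (hC : 0 < C) (ha : 0 < a)
    (hr : 0 < r) (hrR : 2 * r ≤ R) (har : a ≤ r) (hra : r ≤ ξ * a) {m : ℕ}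
    (hR : a * ξ ^ (m + 1) = R)
    (hd : μ (Metric.ball x₀ (2 * r)) ≤ ENNReal.ofReal C * μ (Metric.ball x₀ r)) :
    ∑ k ∈ Finset.range (m + 1 + 1), radialTerm μ x₀ α (a * ξ ^ (k + 1)) ≤
      radialSumConst α ξ C * ∫⁻ t in Ioc r R, radialDensity μ x₀ α t := by
  have hξ0 : 0 < ξ := by linarith
  have hR0 : 0 < R := by linarith
  rw [Finset.sum_range_succ, Finset.sum_range_succ', add_comm (Finset.sum _ _), radialSumConst,
    add_mul, add_mul]
  refine add_le_add (add_le_add ?_ ?_) ?_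
  · rw [zero_add, pow_one, mul_comm a ξ, mul_assoc]
    refine (radialTerm_mul_le hα hξ0 hra (by nlinarith)).trans (mul_le_mul_right ?_ _)
    refine (radialTerm_le_of_doubling hα hC hd).trans ?_
    exact mul_le_mul_right (lintegral_mono_set (Ioc_subset_Ioc_right hrR)) _
  · have h := sum_radialTerm_le_lintegral (μ := μ) (x₀ := x₀) hα hξ (mul_pos hξ0 ha) m
    rw [show ξ * a * ξ ^ m = R by rw [← hR]; ring] at h
    refine le_trans (le_of_eq ?_) (h.trans (mul_le_mul_right
      (lintegral_mono_set (Ioc_subset_Ioc_left hra)) _))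
    refine Finset.sum_congr rfl fun k _ => ?_
    congr 1
    ring
  · rw [show a * ξ ^ (m + 1 + 1) = ξ * R by rw [← hR]; ring, mul_assoc]
    refine (radialTerm_mul_le hα hξ0 (by nlinarith) le_rfl).trans (mul_le_mul_right ?_ _)
    refine (radialTerm_outer_le hα hR0).trans (mul_le_mul_right ?_ _)
    exact lintegral_mono_set (Ioc_subset_Ioc_left (by linarith))

theorem PoincareAt.laverage_le {q C lam s : ℝ} {T : ℝ≥0∞} (hq : 1 ≤ q) (hC : 0 < C)
    (hlam : 1 ≤ lam) (h : PoincareAt q μ x₀ C lam T) (hs : 0 < s) (hsT : ENNReal.ofReal s ≤ T)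
    {w : X → ℝ} (hw : AEMeasurable w μ) (hint : ∫⁻ x, ENNReal.ofReal |w x| ∂μ < ⊤)
    {g : X → ℝ≥0∞} (hg : IsWeakUpperGradient q μ (fun x => (w x : EReal)) g) {S : Set X}
    (hS : Metric.ball x₀ (lam * s) ⊆ S) :
    ⨍⁻ x in Metric.ball x₀ s, ENNReal.ofReal |w x - ⨍ y in Metric.ball x₀ s, w y ∂μ| ∂μ ≤
      ENNReal.ofReal C * (ENNReal.ofReal s *
        ((∫⁻ x in S, g x ^ q ∂μ) / μ (Metric.ball x₀ s)) ^ (1 / q)) := by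
  have h1 := h s hs hsT (fun x => (w x : EReal)) g (measurable_coe_real_ereal.comp_aemeasurable hw)
    (by simpa only [EReal.abs_def] using hint) hg
  simp only [EReal.toReal_coe, abs_coe_sub_coe] at h1
  refine h1.trans ?_
  rw [ENNReal.ofReal_mul hC.le, mul_assoc, setLAverage_eq]
  refine mul_le_mul_right (mul_le_mul_right (ENNReal.rpow_le_rpow ?_ (by positivity)) _) _
  refine ENNReal.div_le_div (lintegral_mono_set hS) (measure_mono (Metric.ball_subset_ball ?_))
  nlinarith

/-- The constant in the lower bound for the capacity of an annulus. -/
noncomputable def capacityLowerConst (p q ξ C_rd C_d C_P : ℝ) (n : ℕ) : ℝ≥0∞ :=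
  ((ENNReal.ofReal (C_rd / (C_rd - 1)) + ENNReal.ofReal C_d ^ n) * ENNReal.ofReal C_P *
      (2 * (ENNReal.ofReal C_d ^ n) ^ (1 / 2 : ℝ)) ^ (1 / q - 1 / p)) ^ p *
    radialSumConst (1 / (p - 1)) ξ C_d ^ (p - 1) *
    ((ENNReal.ofReal C_d ^ n) ^ ((p - q) / (2 * q)) *
      (1 - (ENNReal.ofReal C_rd)⁻¹ ^ ((p - q) / (2 * q)))⁻¹)

theorem capacityLowerConst_ne_top {p q ξ C_rd C_d C_P : ℝ} (hq : 1 ≤ q) (hqp : q < p)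
    (hC_rd : 1 < C_rd) (n : ℕ) : capacityLowerConst p q ξ C_rd C_d C_P n ≠ ⊤ := by
  have hq0 : 0 < q := by linarith
  have hp1 : 0 < p - 1 := by linarith
  have hpq : 0 < p - q := by linarith
  have hD : ENNReal.ofReal C_d ^ n ≠ ⊤ := ENNReal.pow_ne_top ENNReal.ofReal_ne_top
  have hδ : 0 < (p - q) / (2 * q) := by positivity
  refine ENNReal.mul_ne_top (ENNReal.mul_ne_top ?_ ?_) (ENNReal.mul_ne_top ?_ ?_)
  · refine ENNReal.rpow_ne_top_of_nonneg (by linarith) (ENNReal.mul_ne_top (ENNReal.mul_ne_top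
      (ENNReal.add_ne_top.2 ⟨ENNReal.ofReal_ne_top, hD⟩) ENNReal.ofReal_ne_top) ?_)
    refine ENNReal.rpow_ne_top_of_nonneg ?_ (ENNReal.mul_ne_top ENNReal.ofNat_ne_top
      (ENNReal.rpow_ne_top_of_nonneg (by norm_num) hD))
    exact sub_nonneg.2 (one_div_le_one_div_of_le hq0 hqp.le)
  · exact ENNReal.rpow_ne_top_of_nonneg hp1.le (radialSumConst_ne_top (by positivity))
  · exact ENNReal.rpow_ne_top_of_nonneg hδ.le hD
  · rw [Ne, ENNReal.inv_eq_top, tsub_eq_zero_iff_le, not_le]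
    refine ENNReal.rpow_lt_one ?_ hδ
    rw [ENNReal.inv_lt_one, ← ENNReal.ofReal_one]
    exact (ENNReal.ofReal_lt_ofReal_iff (by linarith)).2 hC_rd

/-- The lower energy bound for normalized potentials of an annulus. -/
theorem rpow_lintegral_le_energy [OpensMeasurableSpace X] {p q ξ C_rd C_d C_P lam r R : ℝ}
    {T : ℝ≥0∞} {n c : ℕ} (hq : 1 ≤ q) (hqp : q < p) (hξ : 1 < ξ) (hC_rd : 1 < C_rd)
    (hC_d : 0 < C_d) (hC_P : 0 < C_P) (hlam : 1 ≤ lam) (hc1 : 1 ≤ c) (hc : lam ≤ ξ ^ c)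
    (hn : ξ ^ c ≤ 2 ^ n)
    (hμ : ∀ s : ℝ, 0 < s → 0 < μ (Metric.ball x₀ s) ∧ μ (Metric.ball x₀ s) < ⊤)
    (hr : 0 < r) (hrR : 2 * r ≤ R)
    (hrev : ∀ s : ℝ, 0 < s → s ≤ R →
      ENNReal.ofReal C_rd * μ (Metric.ball x₀ s) ≤ μ (Metric.ball x₀ (ξ * s)))
    (hd : ∀ s : ℝ, 0 < s → 2 * s ≤ max 2 ξ * R →
      μ (Metric.ball x₀ (2 * s)) ≤ ENNReal.ofReal C_d * μ (Metric.ball x₀ s))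
    (hP : PoincareAt q μ x₀ C_P lam T) (hT : ENNReal.ofReal (ξ * R) ≤ T)
    {w : X → ℝ} (hw : AEMeasurable w μ) (hw0 : ∀ x, 0 ≤ w x) (hw1 : ∀ x, w x ≤ 1)
    (hone : ∀ x ∈ Metric.ball x₀ r, w x = 1) (hzero : ∀ x ∉ Metric.ball x₀ R, w x = 0)
    {g : X → ℝ≥0∞} (hg : IsWeakUpperGradient q μ (fun x => (w x : EReal)) g)
    (hg0 : ∀ x ∉ Metric.ball x₀ R, g x = 0) :
    (∫⁻ t in Ioc r R, radialDensity μ x₀ (1 / (p - 1)) t) ^ (1 - p) ≤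
      capacityLowerConst p q ξ C_rd C_d C_P n * ∫⁻ x in Metric.ball x₀ R, g x ^ p ∂μ := by
  have hp0 : 0 < p := by linarith
  have hp1 : 0 < p - 1 := by linarith
  have hq0 : 0 < q := by linarith
  have hα : 0 ≤ 1 / (p - 1) := by positivity
  have hξ0 : 0 < ξ := by linarith
  have hR0 : 0 < R := by linarith
  have hξc : ξ ≤ ξ ^ c := le_self_pow₀ hξ.le (by omega)
  have hfin : ∀ s : ℝ, μ (Metric.ball x₀ s) < ⊤ := fun s => by
    rcases lt_or_ge 0 s with h | h
    · exact (hμ s h).2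
    · simp [Metric.ball_eq_empty.2 h]
  obtain ⟨m, hm1, hm2⟩ := exists_nat_pow_near (x := R / r) (y := ξ)
    (by rw [le_div_iff₀ hr]; linarith) hξ
  rw [le_div_iff₀ hr] at hm1
  rw [div_lt_iff₀ hr] at hm2
  -- The geometric sequence is counted down from R, so that R is exactly one of its radii and the
  -- last ball is B_{ξR}; then a ≤ r ≤ ξa at the inner end.
  set a := R / ξ ^ (m + 1) with ha
  have ha0 : 0 < a := by positivity
  have hR : a * ξ ^ (m + 1) = R := by rw [ha]; field_simp
  have har : a ≤ r := by
    rw [ha, div_le_iff₀ (by positivity), mul_comm]; exact hm2.le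
  have hra : r ≤ ξ * a := by
    rw [ha, pow_succ]
    rw [show ξ * (R / (ξ ^ m * ξ)) = R / ξ ^ m by field_simp, le_div_iff₀ (by positivity),
      mul_comm]
    exact hm1
  set ρ : ℕ → ℝ := fun k => a * ξ ^ k with hρ
  have hρ0 : ∀ k, 0 < ρ k := fun k => by simp only [hρ]; positivity
  have hρmono : Monotone ρ := fun i j hij =>
    mul_le_mul_of_nonneg_left (pow_le_pow_right₀ hξ.le hij) ha0.le
  have hρR : ρ (m + 1) = R := hR
  have hρs : ∀ k, ρ (k + 1) = ξ * ρ k := fun k => by simp only [hρ]; ring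
  have hρadd : ∀ j k, ρ (j + k) = ξ ^ k * ρ j := fun j k => by simp only [hρ]; ring
  have hle : ∀ k ≤ m + 1, ρ k ≤ R := fun k hk => (hρmono hk).trans hρR.le
  set B : ℕ → Set X := fun k => Metric.ball x₀ (ρ k) with hB
  have hBm : ∀ k, MeasurableSet (B k) := fun k => Metric.isOpen_ball.measurableSet
  have hBmono : Monotone B := fun i j hij => Metric.ball_subset_ball (hρmono hij)
  have hBpos : ∀ k, μ (B k) ≠ 0 := fun k => (hμ _ (hρ0 k)).1.ne'
  have hBfin : ∀ k, μ (B k) ≠ ⊤ := fun k => (hμ _ (hρ0 k)).2.ne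
  have hBR : B (m + 1) = Metric.ball x₀ R := by simp only [hB, hρR]
  have hgrow : ∀ k ≤ m + 1, ENNReal.ofReal C_rd * μ (B k) ≤ μ (B (k + 1)) := by
    intro k hk
    have := hrev (ρ k) (hρ0 k) (hle k hk)
    rwa [← hρs] at this
  have hmaxR : R ≤ max 2 ξ * R := by nlinarith [le_max_right 2 ξ]
  -- The dilation λ costs at most c steps of the sequence, and c steps cost at most n doublings.
  have hdoub : ∀ i j, i ≤ m + 1 → i ≤ j + c → μ (B i) ≤ ENNReal.ofReal C_d ^ n * μ (B j) := by
    intro i j hi hij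
    refine measure_ball_le_of_doubling hd n (hρ0 i) ((hle i hi).trans hmaxR) ?_
    calc ρ i ≤ ρ (j + c) := hρmono hij
      _ = ξ ^ c * ρ j := hρadd j c
      _ ≤ 2 ^ n * ρ j := mul_le_mul_of_nonneg_right hn (hρ0 j).le
  have hdoub1 : ∀ k ≤ m + 1, μ (B (k + 1)) ≤ ENNReal.ofReal C_d ^ n * μ (B k) := by
    intro k hk
    refine measure_ball_le_of_doubling hd n (hρ0 _) ?_ ?_
    · rw [hρs]
      exact mul_le_mul (le_max_right _ _) (hle k hk) (hρ0 k).le (by positivity)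
    · rw [hρs]
      exact mul_le_mul_of_nonneg_right (hξc.trans hn) (hρ0 k).le
  have hint : ∫⁻ x, ENNReal.ofReal |w x| ∂μ < ⊤ := by
    calc ∫⁻ x, ENNReal.ofReal |w x| ∂μ ≤ ∫⁻ x, (Metric.ball x₀ R).indicator (fun _ => 1) x ∂μ := by
          refine lintegral_mono fun x => ?_
          by_cases hx : x ∈ Metric.ball x₀ R
          · rw [indicator_of_mem hx, abs_of_nonneg (hw0 x)]
            exact ENNReal.ofReal_le_one.2 (hw1 x)
          · simp [hzero x hx]
      _ < ⊤ := by
          rw [lintegral_indicator_const Metric.isOpen_ball.measurableSet, one_mul]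
          exact hfin R
  have hchain := one_le_mul_sum_laverage hBm hBmono hBpos hBfin hC_rd (hgrow _ le_rfl) hdoub1 hw
    hw0 hw1 (fun x hx => hone x (Metric.ball_subset_ball (by simpa [hρ] using har) hx))
    (by rw [hBR]; exact hzero)
  have hpoin : ∀ k ∈ Finset.range (m + 1 + 1),
      ⨍⁻ x in B (k + 1), ENNReal.ofReal |w x - ⨍ y in B (k + 1), w y ∂μ| ∂μ ≤
        ENNReal.ofReal C_P * (ENNReal.ofReal (ρ (k + 1)) *
          ((∫⁻ x in B (k + 1 + c), g x ^ q ∂μ) / μ (B (k + 1))) ^ (1 / q)) := by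
    intro k hk
    refine hP.laverage_le hq hC_P hlam (hρ0 _) ?_ hw hint hg ?_
    · refine (ENNReal.ofReal_le_ofReal ?_).trans hT
      rw [hρs]
      exact mul_le_mul_of_nonneg_left (hle k (Nat.lt_succ_iff.1 (Finset.mem_range.1 hk))) hξ0.le
    · refine Metric.ball_subset_ball ?_
      rw [hρadd (k + 1) c]
      exact mul_le_mul_of_nonneg_right hc (hρ0 _).le
  have hholder := sum_mul_rpow_mean_le hBm hBmono hBpos hBfin
    (C := ENNReal.ofReal C_rd) (by simp; linarith) ENNReal.ofReal_ne_top hgrow hdoub hq0 hqp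
    (by linarith) hg.1 (by rw [hBR]; exact hg0) (fun k => ENNReal.ofReal (ρ k))
  have hsum := sum_radialTerm_le (μ := μ) (x₀ := x₀) hα hξ hC_d ha0 hr hrR har hra hR
    (hd r hr (hrR.trans hmaxR))
  have hsum' : ∑ k ∈ Finset.range (m + 1 + 1), ENNReal.ofReal (ρ (k + 1)) *
      (ENNReal.ofReal (ρ (k + 1)) / μ (B (k + 1))) ^ (1 / (p - 1)) ≤
        radialSumConst (1 / (p - 1)) ξ C_d *
          ∫⁻ t in Ioc r R, radialDensity μ x₀ (1 / (p - 1)) t := hsum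
  rw [hBR] at hholder
  set H := ∫⁻ t in Ioc r R, radialDensity μ x₀ (1 / (p - 1)) t with hH
  set E := ∫⁻ x in Metric.ball x₀ R, g x ^ p ∂μ with hE
  have hH0 : H ≠ 0 :=
    (lintegral_radialDensity_pos hα hfin hr (by linarith)).ne'
  have hHt : H ≠ ⊤ := (lintegral_radialDensity_lt_top hα (hμ r hr).1).ne
  set D := ENNReal.ofReal C_d ^ n with hD
  set K := radialSumConst (1 / (p - 1)) ξ C_d with hK
  set W := D ^ ((p - q) / (2 * q)) *
      (1 - (ENNReal.ofReal C_rd)⁻¹ ^ ((p - q) / (2 * q)))⁻¹ with hW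
  set Q := (ENNReal.ofReal (C_rd / (C_rd - 1)) + D) * ENNReal.ofReal C_P *
      (2 * D ^ (1 / 2 : ℝ)) ^ (1 / q - 1 / p) with hQ
  have hmain : 1 ≤ Q * ((K * H) ^ ((p - 1) / p) * (W * E) ^ (1 / p)) := by
    refine hchain.trans ?_
    rw [hQ, mul_assoc, mul_assoc]
    refine mul_le_mul_right ?_ _
    refine (Finset.sum_le_sum hpoin).trans ?_
    rw [← Finset.mul_sum]
    refine mul_le_mul_right (hholder.trans (mul_le_mul_right ?_ _)) _
    exact mul_le_mul_left (ENNReal.rpow_le_rpow hsum' (by positivity)) _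
  -- The p-th power turns the exponent (p-1)/p of H into p - 1, to be cancelled by H^(1-p).
  have hpow : 1 ≤ Q ^ p * (K * H) ^ (p - 1) * (W * E) := by
    have := ENNReal.rpow_le_rpow hmain hp0.le
    rwa [ENNReal.one_rpow, ENNReal.mul_rpow_of_nonneg Q _ hp0.le,
      ENNReal.mul_rpow_of_nonneg ((K * H) ^ _) _ hp0.le, ← ENNReal.rpow_mul, ← ENNReal.rpow_mul,
      div_mul_cancel₀ _ hp0.ne', one_div_mul_cancel hp0.ne', ENNReal.rpow_one, ← mul_assoc] at this
  calc H ^ (1 - p) ≤ H ^ (1 - p) * (Q ^ p * (K * H) ^ (p - 1) * (W * E)) :=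
        le_mul_of_one_le_right zero_le hpow
    _ = H ^ (1 - p) * H ^ (p - 1) * (Q ^ p * K ^ (p - 1) * W * E) := by
        rw [ENNReal.mul_rpow_of_nonneg _ _ hp1.le]; ring
    _ = capacityLowerConst p q ξ C_rd C_d C_P n * E := by
        rw [← ENNReal.rpow_add _ _ hH0 hHt, show 1 - p + (p - 1) = 0 by ring, ENNReal.rpow_zero,
          one_mul]
        rfl

/-- An admissible function is truncated to [0, 1], its p-weak upper gradient is read as a q-weak one
and set to zero outside B_R; none of this increases the energy in B_R. -/
theorem rpow_lintegral_le_varCap [OpensMeasurableSpace X] {p q ξ C_rd C_d C_P lam r R : ℝ}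
    {T : ℝ≥0∞} {n c : ℕ} (hq : 1 ≤ q) (hqp : q < p) (hξ : 1 < ξ) (hC_rd : 1 < C_rd)
    (hC_d : 0 < C_d) (hC_P : 0 < C_P) (hlam : 1 ≤ lam) (hc1 : 1 ≤ c) (hc : lam ≤ ξ ^ c)
    (hn : ξ ^ c ≤ 2 ^ n)
    (hμ : ∀ (x : X) (s : ℝ), 0 < s → 0 < μ (Metric.ball x s) ∧ μ (Metric.ball x s) < ⊤)
    (hr : 0 < r) (hrR : 2 * r ≤ R)
    (hrev : ∀ s : ℝ, 0 < s → s ≤ R →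
      ENNReal.ofReal C_rd * μ (Metric.ball x₀ s) ≤ μ (Metric.ball x₀ (ξ * s)))
    (hd : ∀ s : ℝ, 0 < s → 2 * s ≤ max 2 ξ * R →
      μ (Metric.ball x₀ (2 * s)) ≤ ENNReal.ofReal C_d * μ (Metric.ball x₀ s))
    (hP : PoincareAt q μ x₀ C_P lam T) (hT : ENNReal.ofReal (ξ * R) ≤ T) {A : ℝ≥0}
    (hA0 : 0 < A) (hA : capacityLowerConst p q ξ C_rd C_d C_P n ≤ A) :
    (∫⁻ t in Ioc r R, radialDensity μ x₀ (1 / (p - 1)) t) ^ (1 - p) ≤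
      A * varCap p μ (Metric.ball x₀ r) (Metric.ball x₀ R) := by
  have hA0' : (A : ℝ≥0∞) ≠ 0 := ENNReal.coe_ne_zero.2 hA0.ne'
  -- With the finite positive constant moved to the left, the capacity stands alone as an infimum to
  -- be bounded below.
  rw [← ENNReal.div_le_iff' hA0' ENNReal.coe_ne_top]
  refine le_iInf₂ fun u hu => le_iInf₂ fun g hg => ?_
  rw [ENNReal.div_le_iff' hA0' ENNReal.coe_ne_top]
  obtain ⟨⟨hum, -⟩, huzero, huone⟩ := hu
  have hzero : ∀ x ∉ Metric.ball x₀ R, unitClamp (u x) = 0 := fun x hx => by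
    rw [huzero x hx, unitClamp_zero]
  have hug := ((hg.1.of_le (fun x s hs => (hμ x s hs).2) (by linarith : 0 ≤ q)
    hqp.le).unitClamp).indicator Metric.isOpen_ball hzero
  have h := rpow_lintegral_le_energy hq hqp hξ hC_rd hC_d hC_P hlam hc1 hc hn (hμ x₀) hr hrR hrev
    hd hP hT (measurable_unitClamp.comp_aemeasurable hum) (fun x => unitClamp_nonneg _)
    (fun x => unitClamp_le_one _) (fun x hx => unitClamp_of_one_le (huone x hx)) hzero hug
    (fun x hx => indicator_of_notMem hx g)
  refine h.trans (mul_le_mul' hA (le_of_eq ?_))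
  exact setLIntegral_congr_fun Metric.isOpen_ball.measurableSet
    fun x hx => by simp only [indicator_of_mem hx]

end CapacityLowerBound

/-! ### The two-sided estimate -/

theorem ofReal_mul_le_ofReal_mul {a b R : ℝ} {R₀ : ℝ≥0∞} (hb : 0 ≤ b) (h : a ≤ b * R)
    (hR : ENNReal.ofReal R ≤ R₀) : ENNReal.ofReal a ≤ ENNReal.ofReal b * R₀ := by
  refine (ENNReal.ofReal_le_ofReal h).trans ?_
  rw [ENNReal.ofReal_mul hb]
  exact mul_le_mul_right hR _

theorem theorem4p1 (p p₀ : ℝ) (hp : 1 < p) (hp₀ : 1 ≤ p₀) (hp₀p : p₀ < p)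
    (ξ C_rd C_d C_P lam : ℝ) (hξ : 1 < ξ) (hC_rd : 1 < C_rd) (hC_d : 0 < C_d)
    (hC_P : 0 < C_P) (hlam : 1 ≤ lam) :
    ∃ A : ℝ≥0, 0 < A ∧
      ∀ (X : Type*) [MetricSpace X] [Nontrivial X] [MeasurableSpace X] [BorelSpace X]
        (μ : Measure X),
        (∀ (x : X) (s : ℝ), 0 < s → 0 < μ (Metric.ball x s) ∧ μ (Metric.ball x s) < ⊤) →
        ∀ (x₀ : X) (R₀ : ℝ≥0∞), 0 < R₀ →
          ReverseDoublingAt μ x₀ ξ C_rd R₀ →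
          DoublingAt μ x₀ C_d (ENNReal.ofReal (max 1 (ξ / 2)) * R₀) →
          PoincareAt p₀ μ x₀ C_P lam (ENNReal.ofReal (max 2 ξ) * R₀) →
          ∀ r R : ℝ, 0 < r → 2 * r ≤ R → ENNReal.ofReal R ≤ R₀ →
            varCap p μ (Metric.ball x₀ r) (Metric.ball x₀ R) ≤
                A * (∫⁻ ρ in Ioc r R,
                  (ENNReal.ofReal ρ / μ (Metric.ball x₀ ρ)) ^ (1 / (p - 1))) ^ (1 - p) ∧
              (∫⁻ ρ in Ioc r R,
                  (ENNReal.ofReal ρ / μ (Metric.ball x₀ ρ)) ^ (1 / (p - 1))) ^ (1 - p) ≤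
                A * varCap p μ (Metric.ball x₀ r) (Metric.ball x₀ R) := by
  -- The exponent c₀ + 1 is positive, so ξ^(c₀+1) dominates both λ and ξ, and 2^n covers the
  -- dilation as well as a single step of the chain. Both exponents depend only on ξ and λ.
  obtain ⟨c₀, hc₀⟩ := pow_unbounded_of_one_lt lam hξ
  have hc : lam ≤ ξ ^ (c₀ + 1) := hc₀.le.trans (pow_le_pow_right₀ hξ.le (Nat.le_succ c₀))
  obtain ⟨n, hn⟩ := pow_unbounded_of_one_lt (ξ ^ (c₀ + 1)) one_lt_two
  have hU := capacityUpperConst_ne_top (C := C_d) hp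
  have hL := capacityLowerConst_ne_top (ξ := ξ) (C_d := C_d) (C_P := C_P) hp₀ hp₀p hC_rd n
  lift capacityUpperConst p C_d to ℝ≥0 using hU with U hUeq
  lift capacityLowerConst p p₀ ξ C_rd C_d C_P n to ℝ≥0 using hL with V hVeq
  refine ⟨U + V + 1, by positivity, ?_⟩
  intro X _ _ _ _ μ hμ x₀ R₀ _ hrev hd hP r R hr hrR hR
  have hR0 : 0 < R := by linarith
  have hd' : ∀ s : ℝ, 0 < s → 2 * s ≤ max 2 ξ * R →
      μ (Metric.ball x₀ (2 * s)) ≤ ENNReal.ofReal C_d * μ (Metric.ball x₀ s) := by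
    intro s hs hsR
    refine hd s hs (ofReal_mul_le_ofReal_mul (le_max_of_le_left zero_le_one) ?_ hR)
    -- Doubling for radii up to max(1, ξ/2)R reaches balls of radius max(2, ξ)R, which include the
    -- last ball B_{ξR} of the chain.
    rw [show max 1 (ξ / 2) = max 2 ξ / 2 by
      rw [← max_div_div_right zero_le_two, div_self two_ne_zero]]
    linarith
  constructor
  · refine (varCap_ball_le hp (hμ x₀) hC_d hr hrR fun s hs hsR => hd' s hs ?_).trans ?_
    · nlinarith [le_max_left 2 ξ]
    · refine mul_le_mul_left ?_ _
      rw [← hUeq]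
      exact_mod_cast (le_add_right (le_add_right le_rfl) : U ≤ U + V + 1)
  · refine rpow_lintegral_le_varCap hp₀ hp₀p hξ hC_rd hC_d hC_P hlam (Nat.le_add_left 1 c₀) hc hn.le
      hμ hr hrR (fun s hs hsR => hrev s hs ((ENNReal.ofReal_le_ofReal hsR).trans hR)) hd' hP
      (ofReal_mul_le_ofReal_mul (by positivity) ?_ hR) (by positivity) ?_
    · exact mul_le_mul_of_nonneg_right (le_max_right _ _) hR0.le
    · rw [← hVeq]
      exact_mod_cast (le_add_right (le_add_left le_rfl) : V ≤ U + V + 1)
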